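/- Let $M$ be a smooth $3$-manifold with a smooth complex-valued metric $g_{ab}$, i.e. a smooth field of nondegenerate symmetric $\mathbb{C}$-bilinear forms on the complexified tangent bundle $T^{\mathbb{C}}M=\mathbb{C}\otimes TM$ (for example the complexification of a pseudo-Riemannian metric of any signature), and let $\nabla$ be its Levi-Civita connection. Use the curvature conventions $$(\nabla_a\nabla_b-\nabla_b\nabla_a)V^c=R_{abd}{}^{c}V^d,\qquad R_{ab}=R_{acb}{}^{c},\qquad R=g^{ab}R_{ab},\qquad S=\tfrac1{12}R,$$ $$\Phi_{ab}=R_{ab}-\tfrac13Rg_{ab},\qquad \mathrm{P}_{ab}=-\Phi_{ab}-\tfrac1{12}Rg_{ab},\qquad A_{abc}=\nabla_b\mathrm{P}_{ca}-\nabla_c\mathrm{P}_{ba}$$ (tracefree Ricci tensor $\Phi$, Schouten tensor $\mathrm{P}$, Cotton tensor $A$). A null structure is a smooth complex line subbundle $\mathcal{N}\subset T^{\mathbb{C}}M$ that is null for $g$; a generator is a local section spanning it. It is co-geodetic if $g(\nabla_XY,Z)=0$ for all local smooth sections $X,Y$ of $\mathcal{N}^\perp$ and $Z$ of $\mathcal{N}$.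 At a point $p$, given a null line $L\subset T^{\mathbb{C}}_pM$, choose a frame $(k,\ell,n)$ with $k$ spanning $L$, $g(k,k)=g(\ell,\ell)=g(k,n)=g(\ell,n)=0$, $g(k,\ell)=1$, $g(n,n)=-\tfrac12$. The null lines at $p$ are spanned by $\xi(z)=k+2zn+z^2\ell$, $z\in\mathbb{C}\cup\{\infty\}$ (with $\xi(\infty)=\ell$), and the multiplicity of $L=\langle\xi(0)\rangle$ as a principal null line of $\Phi$ is the multiplicity of the root $z=0$ of the quartic $\tfrac12\Phi_{ab}\xi^a(z)\xi^b(z)$ (assumed not identically zero). $\Phi$ is exactly of Petrov type D at $p$, with multiple principal null lines $L,L'$, if $L\neq L'$ and both have multiplicity exactly $2$. **Theorem (Petrov type D).** Let $\mathcal{N}$ and $\mathcal{N}'$ be null structures on $(M,g)$ such that, at every point of $M$, $\Phi_{ab}$ is exactly of Petrov type D with multiple principal null lines given by $\mathcal{N}$ and $\mathcal{N}'$. Suppose that for any generators $k^a$ of $\mathcal{N}$ and $\ell^a$ of $\mathcal{N}'$ $$k^ak^b\left(A_{abc}+3g_{bc}\nabla_aS\right)=0,\qquad \ell^a\ell^b\left(A_{abc}+3g_{bc}\nabla_aS\right)=0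 .$$ Then both $\mathcal{N}$ and $\mathcal{N}'$ are co-geodetic. -/

import Mathlib

open scoped Manifold ContDiff TensorProduct Topology

noncomputable section

namespace NullGeometry

/-! ### Tensor calculus in a coordinate domain

`G x` is the matrix `g_{ij}(x)` of a complex-valued metric in coordinates on (an open subset of)
`ℝ³`.  Only the values of `G` near `x` matter for the objects below, evaluated at `x`. -/

/-- The coordinate space `ℝ³`. -/
abbrev E3 := EuclideanSpace ℝ (Fin 3)

/-- Coordinate partial derivative `∂_i f` of a complex-valued function. -/
def pd (i : Fin 3) (f : E3 → ℂ) (x : E3) : ℂ :=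
  fderiv ℝ f x (EuclideanSpace.single i (1 : ℝ))

/-- Christoffel symbols `Γ^k_{ij}` of the Levi-Civita connection. -/
def christoffel (G : E3 → Matrix (Fin 3) (Fin 3) ℂ) (k i j : Fin 3) (x : E3) : ℂ :=
  (1 / 2) * ∑ l, (G x)⁻¹ k l *
    (pd i (fun y => G y j l) x + pd j (fun y => G y i l) x - pd l (fun y => G y i j) x)

/-- The Riemann tensor `R_{abd}^c`, with the sign convention
`(∇_a ∇_b - ∇_b ∇_a) V^c = R_{abd}^c V^d`. -/
def riemann (G : E3 → Matrix (Fin 3) (Fin 3) ℂ) (a b d c : Fin 3) (x : E3) : ℂ :=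
  pd a (christoffel G c b d) x - pd b (christoffel G c a d) x
    + ∑ e, (christoffel G c a e x * christoffel G e b d x
        - christoffel G c b e x * christoffel G e a d x)

/-- The Ricci tensor, with the convention `R_{ab} = R_{acb}^c` (contraction of the *second* slot;
with this convention round spheres have negative scalar curvature). -/
def ricci (G : E3 → Matrix (Fin 3) (Fin 3) ℂ) (a b : Fin 3) (x : E3) : ℂ :=
  ∑ c, riemann G a c b c x

/-- The Ricci scalar `R = g^{ab} R_{ab}`. -/
def ricciScalar (G : E3 → Matrix (Fin 3) (Fin 3) ℂ) (x : E3) : ℂ :=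
  ∑ a, ∑ b, (G x)⁻¹ a b * ricci G a b x

/-- `S = R / 12`. -/
def scalarS (G : E3 → Matrix (Fin 3) (Fin 3) ℂ) (x : E3) : ℂ :=
  (1 / 12) * ricciScalar G x

/-- The tracefree Ricci tensor `Φ_{ab} = R_{ab} - (1/3) R g_{ab}`. -/
def tracefreeRicci (G : E3 → Matrix (Fin 3) (Fin 3) ℂ) (a b : Fin 3) (x : E3) : ℂ :=
  ricci G a b x - (1 / 3) * ricciScalar G x * G x a b

/-- The Schouten (Rho) tensor `P_{ab} = - Φ_{ab} - (1/12) R g_{ab}`. -/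
def schouten (G : E3 → Matrix (Fin 3) (Fin 3) ℂ) (a b : Fin 3) (x : E3) : ℂ :=
  - tracefreeRicci G a b x - (1 / 12) * ricciScalar G x * G x a b

/-- The covariant derivative `∇_a T_{bc}` of a covariant 2-tensor. -/
def covDeriv₂ (G : E3 → Matrix (Fin 3) (Fin 3) ℂ) (T : Fin 3 → Fin 3 → E3 → ℂ)
    (a b c : Fin 3) (x : E3) : ℂ :=
  pd a (T b c) x
    - ∑ e, (christoffel G e a b x * T e c x + christoffel G e a c x * T b e x)

/-- The Cotton tensor `A_{abc} = 2 ∇_{[b} P_{c]a} = ∇_b P_{ca} - ∇_c P_{ba}`. -/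
def cotton (G : E3 → Matrix (Fin 3) (Fin 3) ℂ) (a b c : Fin 3) (x : E3) : ℂ :=
  covDeriv₂ G (schouten G) b c a x - covDeriv₂ G (schouten G) c b a x

/-- The covariant derivative `(∇_X Y)^k = X^i (∂_i Y^k + Γ^k_{ij} Y^j)` of a vector field. -/
def covDerivVec (G : E3 → Matrix (Fin 3) (Fin 3) ℂ) (X Y : Fin 3 → E3 → ℂ)
    (k : Fin 3) (x : E3) : ℂ :=
  ∑ i, X i x * (pd i (Y k) x + ∑ j, christoffel G k i j x * Y j x)

/-! ### Pointwise algebra: principal null lines and Petrov type D -/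

section Algebra

variable {V : Type*} [AddCommGroup V] [Module ℂ V]

/-- `(k, ℓ, n)` is an adapted null frame: `B = 2 k_{(a} ℓ_{b)} - 2 n_a n_b`. -/
structure IsAdaptedFrame (B : LinearMap.BilinForm ℂ V) (k l n : V) : Prop where
  kk : B k k = 0
  ll : B l l = 0
  kl : B k l = 1
  kn : B k n = 0
  ln : B l n = 0
  nn : B n n = -1 / 2

/-- The null vector `ξ(z) = k + 2 z n + z² ℓ`; as `z` varies over `ℂ` (with `ξ(∞) = ℓ`) this
parametrises all the null lines. -/
def nullVec (k l n : V) (z : ℂ) : V := k + (2 * z) • n + z ^ 2 • l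

/-- The quartic `Φ(z) = (1/2) Φ_{ab} ξ^a(z) ξ^b(z)` as a polynomial in `z`. -/
def ricciPoly (Φ : LinearMap.BilinForm ℂ V) (k l n : V) : Polynomial ℂ :=
  Polynomial.C (1 / 2 * Φ k k)
    + Polynomial.C (Φ k n + Φ n k) * Polynomial.X
    + Polynomial.C (1 / 2 * (Φ k l + Φ l k) + 2 * Φ n n) * Polynomial.X ^ 2
    + Polynomial.C (Φ n l + Φ l n) * Polynomial.X ^ 3
    + Polynomial.C (1 / 2 * Φ l l) * Polynomial.X ^ 4

theorem eval_ricciPoly (Φ : LinearMap.BilinForm ℂ V) (k l n : V) (z : ℂ) :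
    (ricciPoly Φ k l n).eval z = 1 / 2 * Φ (nullVec k l n z) (nullVec k l n z) := by
  simp only [ricciPoly, nullVec, map_add, map_smul, LinearMap.add_apply, LinearMap.smul_apply,
    smul_eq_mul, Polynomial.eval_add, Polynomial.eval_mul, Polynomial.eval_C, Polynomial.eval_X,
    Polynomial.eval_pow]
  ring

/-- The line `L` is a principal null line of `Φ` of multiplicity exactly `m`: in a frame
`(k, ℓ, n)` adapted to `L` (i.e. `L` is spanned by `k = ξ(0)`) the quartic `Φ(z)` is not
identically zero and has `z = 0` as a root of multiplicity `m`. -/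
def HasPrincipalMultiplicity (B Φ : LinearMap.BilinForm ℂ V) (L : Submodule ℂ V) (m : ℕ) : Prop :=
  ∃ k l n : V, IsAdaptedFrame B k l n ∧ L = Submodule.span ℂ {k} ∧
    ricciPoly Φ k l n ≠ 0 ∧ (ricciPoly Φ k l n).rootMultiplicity 0 = m

/-- `Φ` is exactly of Petrov type D with `L`, `L'` as its multiple principal null lines: the root
pattern of the quartic is `{2, 2}`, the two distinct double roots corresponding to `L` and `L'`. -/
def IsTypeD (B Φ : LinearMap.BilinForm ℂ V) (L L' : Submodule ℂ V) : Prop :=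
  L ≠ L' ∧ HasPrincipalMultiplicity B Φ L 2 ∧ HasPrincipalMultiplicity B Φ L' 2

end Algebra

/-! ### Complex-valued metrics and null structures on 3-manifolds -/

section Manifold

variable {M : Type*} [TopologicalSpace M] [ChartedSpace E3 M]

/-- The complexified tangent space `ℂ ⊗ T_p M`. -/
abbrev CTangent (p : M) : Type := ℂ ⊗[ℝ] TangentSpace (𝓡 3) p

/-- The coordinate vector `∂_i` of the chart `c` at the point with coordinates `x`. -/
def coordVec (c : OpenPartialHomeomorph M E3) (x : E3) (i : Fin 3) : CTangent (c.symm x) :=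
  (1 : ℂ) ⊗ₜ[ℝ] (mfderiv (𝓡 3) (𝓡 3) c.symm x (EuclideanSpace.single i (1 : ℝ)) :
    TangentSpace (𝓡 3) (c.symm x))

/-- The coordinate differential `dx^i` of the chart `c` at `p`. -/
def dcoord (c : OpenPartialHomeomorph M E3) (p : M) (i : Fin 3) : TangentSpace (𝓡 3) p →ₗ[ℝ] ℝ where
  toFun v := (show E3 from mfderiv (𝓡 3) (𝓡 3) c p v) i
  map_add' v w := by rw [map_add]; rfl
  map_smul' a v := by rw [map_smul]; rfl

/-- The `i`-th component, in the chart `c`, of complexified tangent vectors at `p`: the ℂ-linear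
extension of `dx^i`. -/
def comp (c : OpenPartialHomeomorph M E3) (p : M) (i : Fin 3) : CTangent p →ₗ[ℂ] ℂ :=
  (TensorProduct.AlgebraTensorModule.rid ℝ ℂ ℂ).toLinearMap ∘ₗ LinearMap.baseChange ℂ (dcoord c p i)

theorem comp_tmul (c : OpenPartialHomeomorph M E3) (p : M) (i : Fin 3) (a : ℂ)
    (v : TangentSpace (𝓡 3) p) : comp c p i (a ⊗ₜ[ℝ] v) = dcoord c p i v • a := by
  simp [comp]

variable (M) in
/-- The charts of the smooth structure of `M` (the maximal smooth atlas). -/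
abbrev charts : Set (OpenPartialHomeomorph M E3) := IsManifold.maximalAtlas (𝓡 3) ∞ M

/-- The components, as functions of the coordinates of the chart `c`, of a complex vector field. -/
def fieldComp (X : ∀ p : M, CTangent p) (c : OpenPartialHomeomorph M E3) (i : Fin 3) (x : E3) : ℂ :=
  comp c (c.symm x) i (X (c.symm x))

/-- The complex vector field `X` is smooth on `U`. -/
def IsSmoothFieldOn (X : ∀ p : M, CTangent p) (U : Set M) : Prop :=
  ∀ c ∈ charts M, ∀ i, ContDiffOn ℝ ∞ (fieldComp X c i) (c.target ∩ c.symm ⁻¹' U)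

variable (M) in
/-- A smooth complex-valued metric on `M`: a smooth field of nondegenerate symmetric ℂ-bilinear
forms on the complexified tangent spaces.  The complexification of a (pseudo-)Riemannian metric, of
any signature, is one. -/
structure ComplexMetric where
  form : ∀ p : M, LinearMap.BilinForm ℂ (CTangent p)
  symm : ∀ p u v, form p u v = form p v u
  nondegenerate : ∀ p u, (∀ v, form p u v = 0) → u = 0
  smooth : ∀ c ∈ charts M, ∀ i j,
    ContDiffOn ℝ ∞ (fun x => form (c.symm x) (coordVec c x i) (coordVec c x j)) c.target

namespace ComplexMetric

/-- The matrix `g_{ij}` of the metric in the chart `c`. -/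
def coeff (g : ComplexMetric M) (c : OpenPartialHomeomorph M E3) (x : E3) :
    Matrix (Fin 3) (Fin 3) ℂ :=
  Matrix.of fun i j => g.form (c.symm x) (coordVec c x i) (coordVec c x j)

/-- The tracefree Ricci tensor at `p`, computed in the chart `c`, as a bilinear form
`(u, v) ↦ Φ_{ij} u^i v^j` on the complexified tangent space. -/
def tracefreeRicciAt (g : ComplexMetric M) (c : OpenPartialHomeomorph M E3) (p : M) :
    LinearMap.BilinForm ℂ (CTangent p) :=
  ∑ i, ∑ j, tracefreeRicci (g.coeff c) i j (c p) •
    LinearMap.BilinForm.linMulLin (comp c p i) (comp c p j)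

/-- The equation `k^a k^b (A_{abm} + 3 g_{bm} ∇_a S) = 0` at `p` for a vector `k` at `p`, in the
chart `c`. -/
def TypeIIObstructionVanishesAt (g : ComplexMetric M) (c : OpenPartialHomeomorph M E3) (p : M)
    (k : CTangent p) : Prop :=
  ∀ m : Fin 3, ∑ a, ∑ b, comp c p a k * comp c p b k *
    (cotton (g.coeff c) a b m (c p) + 3 * g.coeff c (c p) b m * pd a (scalarS (g.coeff c)) (c p)) = 0

end ComplexMetric

/-- A null structure: a smooth complex line subbundle of the complexified tangent bundle, null with
respect to `g`. -/
structure NullStructure (g : ComplexMetric M) where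
  line : ∀ p : M, Submodule ℂ (CTangent p)
  finrank_line : ∀ p, Module.finrank ℂ (line p) = 1
  null : ∀ p, ∀ v ∈ line p, g.form p v v = 0
  smooth : ∀ p : M, ∃ U : Set M, IsOpen U ∧ p ∈ U ∧ ∃ k : ∀ q : M, CTangent q,
    IsSmoothFieldOn k U ∧ ∀ q ∈ U, line q = Submodule.span ℂ {k q}

namespace NullStructure

variable {g : ComplexMetric M}

/-- The orthogonal complement `N^⊥` of a null structure. -/
def perp (N : NullStructure g) (p : M) : Submodule ℂ (CTangent p) :=
  (g.form p).orthogonal (N.line p)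

/-- The type II condition holds along `N`: `k^a k^b (A_{abc} + 3 g_{bc} ∇_a S) = 0` everywhere, for
any generator `k` of `N`. -/
def TypeIIObstructionVanishes (N : NullStructure g) : Prop :=
  ∀ c ∈ charts M, ∀ p ∈ c.source, ∀ k : CTangent p, N.line p = Submodule.span ℂ {k} →
    g.TypeIIObstructionVanishesAt c p k

/-- `N` is co-geodetic: `g (∇_X Y, Z) = 0` for all (local) sections `X`, `Y` of `N^⊥` and
`Z` of `N`. -/
def IsCoGeodetic (N : NullStructure g) : Prop :=
  ∀ U : Set M, IsOpen U → ∀ X Y Z : ∀ p : M, CTangent p,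
    IsSmoothFieldOn X U → IsSmoothFieldOn Y U → IsSmoothFieldOn Z U →
    (∀ p ∈ U, X p ∈ N.perp p) → (∀ p ∈ U, Y p ∈ N.perp p) → (∀ p ∈ U, Z p ∈ N.line p) →
    ∀ c ∈ charts M, ∀ p ∈ c.source, p ∈ U →
      ∑ a, ∑ b, g.coeff c (c p) a b *
        covDerivVec (g.coeff c) (fieldComp X c) (fieldComp Y c) a (c p) *
          fieldComp Z c b (c p) = 0

end NullStructure

/-- The tracefree Ricci tensor is exactly of Petrov type D at every point of `M`, with `N` and `N'`
as its multiple principal null structures. -/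
def IsTypeDWith (g : ComplexMetric M) (N N' : NullStructure g) : Prop :=
  ∀ c ∈ charts M, ∀ p ∈ c.source,
    IsTypeD (g.form p) (g.tracefreeRicciAt c p) (N.line p) (N'.line p)

end Manifold

end NullGeometry

end

/-! Fix a generator `k` of the first null structure, smooth near the point. Type D supplies,
pointwise, a frame `(k, l, n)` with `l` spanning the other line; since `Φ` is tracefree it must be
`f (g + 6 n ⊗ n)` with `f ≠ 0`. So `k` has eigenvalue `f` and `n` has eigenvalue `-2f`
(`IsAdaptedFrame.normal_form`).

Differentiate the eigenvector equation of `k`, written through 2×2 minors so that `f` is never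
differentiated. With `δ(x, y) = x^b y^a k^c ∇_b Φ_{ac}` this gives `δ(x, k) = 0` and `δ(x, n) = 3f
g(n, ∇_x k)`. The type II condition contracted with `n` says `δ(k, n) = 0`; contracted with `l` it
says `δ(k, l) = 2 k·∇S`. The contracted Bianchi identity gives `δ(k, l) + δ(l, k) - 2 δ(n, n) = 2
k·∇S`, hence `δ(n, n) = 0`. As `f ≠ 0`, both `g(n, ∇_k k)` and `g(n, ∇_n k)` vanish
(`geodetic_of_obstruction`). Since `k` and `n` span `k^⊥` and `g(k, ∇k) = 0`, this is
co-geodeticity, after moving the derivative from `Y` to `k` by metric compatibility. The other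
structure follows by exchanging roles.

The tensor identities behind this (`contracted_bianchi`, `derivation_eigenvector`) are proved by
algebra over a commutative ring with derivations, commuting where curvature identities need it, then
specialised to smooth functions on a coordinate domain and evaluated at points. -/

noncomputable section

namespace NullGeometry

/-! ### Connections and curvature over a commutative ring with derivations. -/

section DerivationCalculus

variable {A ι : Type*} [CommRing A] [Algebra ℂ A]

theorem map_add_derivation (D : Derivation ℂ A A) (M N : Matrix ι ι A) :
    (M + N).map D = M.map D + N.map D := by
  ext i j; simp

theorem map_sub_derivation (D : Derivation ℂ A A) (M N : Matrix ι ι A) :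
    (M - N).map D = M.map D - N.map D := by
  ext i j; simp

variable [Fintype ι]

theorem map_mul_derivation (D : Derivation ℂ A A) (M N : Matrix ι ι A) :
    (M * N).map D = M.map D * N + M * N.map D := by
  ext i j
  simp only [Matrix.map_apply, Matrix.mul_apply, Matrix.add_apply, map_sum, Derivation.leibniz,
    smul_eq_mul, ← Finset.sum_add_distrib]
  exact Finset.sum_congr rfl fun _ _ => by ring

/-- The curvature matrices `(R_{ab})^c_d` of a connection with connection matrices
`(Γ_a)^c_d = Γ^c_{ad}`, in a commutative ring with derivations `D_a`. -/
def curvature (D : ι → Derivation ℂ A A) (Γ : ι → Matrix ι ι A) (a b : ι) : Matrix ι ι A :=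
  (Γ b).map (D a) - (Γ a).map (D b) + (Γ a * Γ b - Γ b * Γ a)

/-- The covariant derivative `∇_e R_{ab}` of the curvature, as a matrix. -/
def covCurvature (D : ι → Derivation ℂ A A) (Γ : ι → Matrix ι ι A) (e a b : ι) :
    Matrix ι ι A :=
  (curvature D Γ a b).map (D e) + (Γ e * curvature D Γ a b - curvature D Γ a b * Γ e)
    - ∑ f, (Γ e f a • curvature D Γ f b + Γ e f b • curvature D Γ a f)

/-- The Ricci tensor of a connection. -/
def connRicci (D : ι → Derivation ℂ A A) (Γ : ι → Matrix ι ι A) (a b : ι) : A :=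
  ∑ c, curvature D Γ a c c b

/-- The covariant derivative of a covariant 2-tensor. -/
def connDeriv₂ (D : ι → Derivation ℂ A A) (Γ : ι → Matrix ι ι A) (T : ι → ι → A) (a b c : ι) : A :=
  D a (T b c) - ∑ e, (Γ a e b * T e c + Γ a e c * T b e)

variable {D : ι → Derivation ℂ A A} {Γ : ι → Matrix ι ι A}

theorem curvature_antisymm (a b : ι) : curvature D Γ b a = -curvature D Γ a b := by
  simp only [curvature]; abel

theorem covCurvature_antisymm (e a b : ι) :
    covCurvature D Γ e b a = -covCurvature D Γ e a b := by
  have h : (curvature D Γ b a).map (D e) = -(curvature D Γ a b).map (D e) := by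
    rw [curvature_antisymm]; ext; simp
  have h2 : ∑ f, (Γ e f b • curvature D Γ f a + Γ e f a • curvature D Γ b f)
      = -∑ f, (Γ e f a • curvature D Γ f b + Γ e f b • curvature D Γ a f) := by
    rw [← Finset.sum_neg_distrib]
    refine Finset.sum_congr rfl fun f _ => ?_
    rw [curvature_antisymm a f, curvature_antisymm f b]
    simp only [smul_neg]; abel
  simp only [covCurvature]
  rw [h, h2, curvature_antisymm a b]
  simp only [mul_neg, neg_mul]; abel

/-- The index corrections cancel in pairs by torsion-freeness and antisymmetry of the curvature.
What remains is the Jacobi identity for the operators `D_a + Γ_a`, valid because the `D_a` commute.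
-/
theorem second_bianchi (hD : ∀ i j x, D i (D j x) = D j (D i x))
    (hΓ : ∀ a b c, Γ a c b = Γ b c a) (e a b : ι) :
    covCurvature D Γ e a b + covCurvature D Γ a b e + covCurvature D Γ b e a = 0 := by
  have hc : ∀ (i j : ι) (M : Matrix ι ι A), (M.map (D j)).map (D i) = (M.map (D i)).map (D j) := by
    intro i j M; ext; simp [hD i j]
  have h2 : ∑ f, (Γ e f a • curvature D Γ f b + Γ e f b • curvature D Γ a f)
      + ∑ f, (Γ a f b • curvature D Γ f e + Γ a f e • curvature D Γ b f)
      + ∑ f, (Γ b f e • curvature D Γ f a + Γ b f a • curvature D Γ e f) = 0 := by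
    rw [← Finset.sum_add_distrib, ← Finset.sum_add_distrib]
    refine Finset.sum_eq_zero fun f _ => ?_
    rw [hΓ e a, hΓ e b, hΓ a b, curvature_antisymm f a, curvature_antisymm f b,
      curvature_antisymm f e]
    simp only [smul_neg]; abel
  have h1 : ((curvature D Γ a b).map (D e) + (Γ e * curvature D Γ a b - curvature D Γ a b * Γ e))
      + ((curvature D Γ b e).map (D a) + (Γ a * curvature D Γ b e - curvature D Γ b e * Γ a))
      + ((curvature D Γ e a).map (D b) + (Γ b * curvature D Γ e a - curvature D Γ e a * Γ b))
      = 0 := by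
    simp only [curvature, map_add_derivation, map_sub_derivation, map_mul_derivation]
    rw [hc e a, hc e b, hc a b]
    noncomm_ring
  simp only [covCurvature]
  rw [← sub_eq_zero.mpr (h1.trans h2.symm)]
  abel

/-- Covariant differentiation commutes with contracting an upper against a lower index: the two
corrections for the contracted pair have opposite signs and agree after renaming. -/
theorem connDeriv₂_connRicci (e a b : ι) :
    connDeriv₂ D Γ (connRicci D Γ) e a b = ∑ c, covCurvature D Γ e a c c b := by
  have h : ∑ c, ∑ f, Γ e c f * curvature D Γ a c f b
      = ∑ c, ∑ f, Γ e f c * curvature D Γ a f c b := Finset.sum_comm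
  simp only [connDeriv₂, connRicci, covCurvature, map_sum, Matrix.add_apply, Matrix.sub_apply,
    Matrix.map_apply, Matrix.mul_apply, Matrix.sum_apply, Matrix.smul_apply, smul_eq_mul,
    Finset.sum_add_distrib, Finset.sum_sub_distrib, Finset.mul_sum]
  rw [h, Finset.sum_comm (f := fun x i => Γ e x a * curvature D Γ x i i b),
    Finset.sum_comm (f := fun x i => Γ e x b * curvature D Γ a i i x)]
  simp only [mul_comm (Γ e _ b)]
  ring

theorem first_bianchi (hΓ : ∀ a b c, Γ a c b = Γ b c a) (a b c d : ι) :
    curvature D Γ a b c d + curvature D Γ b d c a + curvature D Γ d a c b = 0 := by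
  simp only [curvature, Matrix.add_apply, Matrix.sub_apply, Matrix.map_apply, Matrix.mul_apply]
  simp only [hΓ b a, hΓ d a, hΓ d b]
  ring

/-- Metric compatibility makes the curvature skew. -/
theorem transpose_curvature_mul (hD : ∀ i j x, D i (D j x) = D j (D i x)) {g : Matrix ι ι A}
    (hg : ∀ a, g.map (D a) = (Γ a).transpose * g + g * Γ a) (a b : ι) :
    (curvature D Γ a b).transpose * g + g * curvature D Γ a b = 0 := by
  -- Second derivatives of `g` commute; substituting compatibility twice leaves exactly the
  -- curvature terms.
  have hc : (g.map (D b)).map (D a) = (g.map (D a)).map (D b) := by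
    ext; simp [hD a b]
  rw [hg, hg] at hc
  simp only [map_add_derivation, map_mul_derivation, hg, Matrix.transpose_map] at hc
  rw [← sub_eq_zero] at hc
  rw [← hc]
  simp only [curvature, Matrix.transpose_add, Matrix.transpose_sub, Matrix.transpose_mul]
  noncomm_ring

/-- The covariant derivative `∇_b V^a` of a vector. -/
def connDerivVec (D : ι → Derivation ℂ A A) (Γ : ι → Matrix ι ι A) (V : ι → A) (b a : ι) : A :=
  D b (V a) + ∑ j, Γ b a j * V j

/-- The last sum appears because the contraction is still a covector in the free index `a`. -/
theorem derivation_contract (T : ι → ι → A) (V : ι → A) (b a : ι) :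
    D b (∑ c, T a c * V c) = ∑ c, connDeriv₂ D Γ T b a c * V c
      + ∑ c, T a c * connDerivVec D Γ V b c + ∑ e, Γ b e a * ∑ c, T e c * V c := by
  have h1 : ∑ c, ∑ e, Γ b e c * T a e * V c = ∑ c, ∑ e, T a c * (Γ b c e * V e) := by
    rw [Finset.sum_comm]
    exact Finset.sum_congr rfl fun _ _ => Finset.sum_congr rfl fun _ _ => by ring
  have h2 : ∑ c, ∑ e, Γ b e a * T e c * V c = ∑ e, ∑ c, Γ b e a * (T e c * V c) := by
    rw [Finset.sum_comm]
    exact Finset.sum_congr rfl fun _ _ => Finset.sum_congr rfl fun _ _ => by ring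
  simp only [connDeriv₂, connDerivVec, map_sum, Derivation.leibniz, smul_eq_mul, sub_mul,
    Finset.sum_mul, Finset.mul_sum, mul_add, add_mul, Finset.sum_add_distrib,
    Finset.sum_sub_distrib]
  rw [h1, h2]
  simp only [mul_comm (V _) (D b _)]
  ring

theorem derivation_contract_vec (v V : ι → A) (b : ι) :
    D b (∑ a, v a * V a) = ∑ a, (D b (v a) - ∑ e, Γ b e a * v e) * V a
      + ∑ a, v a * connDerivVec D Γ V b a := by
  have h1 : ∑ a, ∑ e, Γ b e a * v e * V a = ∑ a, ∑ e, v a * (Γ b a e * V e) := by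
    rw [Finset.sum_comm]
    exact Finset.sum_congr rfl fun _ _ => Finset.sum_congr rfl fun _ _ => by ring
  simp only [connDerivVec, map_sum, Derivation.leibniz, smul_eq_mul, sub_mul, mul_add,
    Finset.sum_mul, Finset.mul_sum, Finset.sum_add_distrib, Finset.sum_sub_distrib]
  rw [h1]
  simp only [mul_comm (V _) (D b _)]
  ring

theorem connDeriv₂_metric {g : Matrix ι ι A}
    (hg : ∀ a, g.map (D a) = (Γ a).transpose * g + g * Γ a) (a b c : ι) :
    connDeriv₂ D Γ g a b c = 0 := by
  have := congrFun₂ (hg a) b c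
  simp only [Matrix.map_apply, Matrix.add_apply, Matrix.mul_apply, Matrix.transpose_apply] at this
  simp only [connDeriv₂, this, Finset.sum_add_distrib, mul_comm (g b _)]
  ring

/-- If `V` is an eigenvector of `T` relative to `g`, this is the derivative of that condition. -/
theorem derivation_eigenvector {g : Matrix ι ι A}
    (hg : ∀ a, g.map (D a) = (Γ a).transpose * g + g * Γ a) (T : ι → ι → A) (V : ι → A)
    (h : ∀ a d, (∑ c, T a c * V c) * (∑ c, g d c * V c)
      = (∑ c, T d c * V c) * (∑ c, g a c * V c)) (b a d : ι) :
    (∑ c, connDeriv₂ D Γ T b a c * V c + ∑ c, T a c * connDerivVec D Γ V b c)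
        * (∑ c, g d c * V c)
      + (∑ c, T a c * V c) * (∑ c, g d c * connDerivVec D Γ V b c)
    = (∑ c, connDeriv₂ D Γ T b d c * V c + ∑ c, T d c * connDerivVec D Γ V b c)
        * (∑ c, g a c * V c)
      + (∑ c, T d c * V c) * (∑ c, g a c * connDerivVec D Γ V b c) := by
  have hd := congrArg (D b) (h a d)
  simp only [Derivation.leibniz, smul_eq_mul] at hd
  rw [derivation_contract (Γ := Γ) T V b a, derivation_contract (Γ := Γ) T V b d,
    derivation_contract (Γ := Γ) g V b a, derivation_contract (Γ := Γ) g V b d] at hd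
  simp only [connDeriv₂_metric hg, zero_mul, Finset.sum_const_zero, zero_add] at hd
  -- The connection terms for the free indices `a` and `d` cancel by the undifferentiated equation,
  -- used at `(e, d)` and `(e, a)`.
  have e1 : (∑ e, Γ b e a * ∑ c, T e c * V c) * (∑ c, g d c * V c)
      = (∑ c, T d c * V c) * ∑ e, Γ b e a * ∑ c, g e c * V c := by
    rw [Finset.sum_mul, Finset.mul_sum]
    exact Finset.sum_congr rfl fun e _ => by linear_combination Γ b e a * h e d
  have e2 : (∑ e, Γ b e d * ∑ c, T e c * V c) * (∑ c, g a c * V c)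
      = (∑ c, T a c * V c) * ∑ e, Γ b e d * ∑ c, g e c * V c := by
    rw [Finset.sum_mul, Finset.mul_sum]
    exact Finset.sum_congr rfl fun e _ => by linear_combination Γ b e d * h e a
  linear_combination hd - e1 + e2

/-- Differentiating the orthogonality `g(V, W) = 0`. -/
theorem derivation_orthogonal {g : Matrix ι ι A}
    (hg : ∀ a, g.map (D a) = (Γ a).transpose * g + g * Γ a) (V W : ι → A)
    (h : ∑ a, (∑ c, g a c * V c) * W a = 0) (b : ι) :
    ∑ a, (∑ c, g a c * connDerivVec D Γ V b c) * W a
      + ∑ a, (∑ c, g a c * V c) * connDerivVec D Γ W b a = 0 := by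
  have hd := congrArg (D b) h
  rw [derivation_contract_vec (Γ := Γ), map_zero] at hd
  simp only [derivation_contract (Γ := Γ) g V, connDeriv₂_metric hg, zero_mul,
    Finset.sum_const_zero, zero_add, add_sub_cancel_right] at hd
  exact hd

theorem connDeriv₂_neg (T : ι → ι → A) (a b c : ι) :
    connDeriv₂ D Γ (fun i j => -T i j) a b c = -connDeriv₂ D Γ T a b c := by
  simp only [connDeriv₂, map_neg, mul_neg, ← neg_add, Finset.sum_neg_distrib]
  ring

theorem connDeriv₂_sub_smul_metric {g : Matrix ι ι A}
    (hg : ∀ a, g.map (D a) = (Γ a).transpose * g + g * Γ a) (T : ι → ι → A) (r : A)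
    (a b c : ι) :
    connDeriv₂ D Γ (fun i j => T i j - r * g i j) a b c
      = connDeriv₂ D Γ T a b c - D a r * g b c := by
  have h := connDeriv₂_metric hg a b c
  simp only [connDeriv₂] at h
  have hs : ∑ e, (Γ a e b * (T e c - r * g e c) + Γ a e c * (T b e - r * g b e))
      = ∑ e, (Γ a e b * T e c + Γ a e c * T b e)
        - r * ∑ e, (Γ a e b * g e c + Γ a e c * g b e) := by
    rw [Finset.mul_sum, ← Finset.sum_sub_distrib]
    exact Finset.sum_congr rfl fun _ _ => by ring
  simp only [connDeriv₂, hs, map_sub, Derivation.leibniz, smul_eq_mul]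
  linear_combination (-r) * h

/-- The Levi-Civita connection matrices of `g`, where `h` is the inverse of `g`. -/
def leviCivita (D : ι → Derivation ℂ A A) (g h : Matrix ι ι A) (i : ι) : Matrix ι ι A :=
  Matrix.of fun k j => (1 / 2 : ℂ) • ∑ l, h k l * (D i (g j l) + D j (g i l) - D l (g i j))

theorem leviCivita_torsionFree {g h : Matrix ι ι A} (hsymm : ∀ a b, g a b = g b a) (a b c : ι) :
    leviCivita D g h a c b = leviCivita D g h b c a := by
  simp only [leviCivita, Matrix.of_apply, hsymm a b]
  congr 1
  exact Finset.sum_congr rfl fun l _ => by ring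

variable [DecidableEq ι]

theorem mul_add_mul_transpose_inverse {B : Type*} [CommRing B] {g h : Matrix ι ι B}
    (hgh : g * h = 1) {R : Matrix ι ι B} (hR : R.transpose * g + g * R = 0) : R * h + h * R.transpose = 0 := by
  have hhg : h * g = 1 := mul_eq_one_comm.mp hgh
  have : h * (R.transpose * g + g * R) * h = h * R.transpose * (g * h) + h * g * (R * h) := by
    noncomm_ring
  rw [hR, hgh, hhg] at this
  simp at this
  rw [add_comm]; exact this.symm

/-- Differentiate `h * g = 1` and multiply by `h` on the right: the inverse metric is parallel too.
-/
theorem map_inverse_of_compatible {g h : Matrix ι ι A} (hgh : g * h = 1)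
    (hg : ∀ a, g.map (D a) = (Γ a).transpose * g + g * Γ a) (a : ι) :
    h.map (D a) = -(Γ a * h + h * (Γ a).transpose) := by
  have hhg : h * g = 1 := mul_eq_one_comm.mp hgh
  have h1 : (h * g).map (D a) = 0 := by
    rw [hhg]; ext i j
    by_cases hij : i = j <;> simp [hij]
  rw [map_mul_derivation, hg] at h1
  have h2 : h.map (D a) * (g * h) = -(h * (Γ a).transpose * (g * h) + h * g * (Γ a * h)) := by
    have : (h.map (D a) * g + h * ((Γ a).transpose * g + g * Γ a)) * h = 0 := by rw [h1, zero_mul]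
    rw [← sub_eq_zero, ← this]; noncomm_ring
  rw [hgh, hhg] at h2
  simpa [add_comm] using h2

/-- Because `h` is parallel, differentiating the skewness of the curvature covariantly preserves it.
-/
theorem covCurvature_mul_add (hD : ∀ i j x, D i (D j x) = D j (D i x)) {g h : Matrix ι ι A}
    (hgh : g * h = 1) (hg : ∀ a, g.map (D a) = (Γ a).transpose * g + g * Γ a) (e a b : ι) :
    covCurvature D Γ e a b * h + h * (covCurvature D Γ e a b).transpose = 0 := by
  have hR : ∀ a b, curvature D Γ a b * h + h * (curvature D Γ a b).transpose = 0 := fun a b =>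
    mul_add_mul_transpose_inverse hgh (transpose_curvature_mul hD hg a b)
  have hs : (∑ f, (Γ e f a • curvature D Γ f b + Γ e f b • curvature D Γ a f)) * h
      + h * (∑ f, (Γ e f a • curvature D Γ f b + Γ e f b • curvature D Γ a f)).transpose = 0 := by
    rw [Matrix.transpose_sum, Finset.sum_mul, Finset.mul_sum, ← Finset.sum_add_distrib]
    refine Finset.sum_eq_zero fun f _ => ?_
    have h1 := congrArg (Γ e f a • ·) (hR f b)
    have h2 := congrArg (Γ e f b • ·) (hR a f)
    simp only [smul_add, smul_zero] at h1 h2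
    rw [Matrix.transpose_add, Matrix.transpose_smul, Matrix.transpose_smul, add_mul, mul_add,
      Matrix.smul_mul, Matrix.smul_mul, Matrix.mul_smul, Matrix.mul_smul,
      ← add_zero (0 : Matrix ι ι A)]
    nth_rewrite 2 [← h2]
    rw [← h1]; abel
  set R := curvature D Γ a b with hRdef
  have hR0 : R * h + h * R.transpose = 0 := hR a b
  have hd : (R * h + h * R.transpose).map (D e) = 0 := by rw [hR0]; ext; simp
  rw [map_add_derivation, map_mul_derivation, map_mul_derivation,
    map_inverse_of_compatible hgh hg, Matrix.transpose_map] at hd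
  simp only [covCurvature, ← hRdef, Matrix.transpose_add, Matrix.transpose_sub,
    Matrix.transpose_mul]
  have e1 : Γ e * (R * h + h * R.transpose) = 0 := by rw [hR0, mul_zero]
  have e2 : (R * h + h * R.transpose) * (Γ e).transpose = 0 := by rw [hR0, zero_mul]
  have key := congrArg₂ (· - ·) (congrArg₂ (· + ·) hd (congrArg₂ (· + ·) e1 e2)) hs
  simp only [add_zero, sub_zero] at key
  rw [← key]
  noncomm_ring

/-- The Ricci tensor of a metric connection is symmetric. -/
theorem connRicci_symm (hD : ∀ i j x, D i (D j x) = D j (D i x))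
    (hΓ : ∀ a b c, Γ a c b = Γ b c a) {g h : Matrix ι ι A} (hgh : g * h = 1)
    (hg : ∀ a, g.map (D a) = (Γ a).transpose * g + g * Γ a) (a b : ι) :
    connRicci D Γ a b = connRicci D Γ b a := by
  -- A `g`-skew endomorphism is conjugate to minus its transpose, so twice its trace vanishes; 2 is
  -- invertible in a `ℂ`-algebra. The first Bianchi identity then turns this into symmetry.
  have htr : ∑ c, curvature D Γ b a c c = 0 := by
    have h1 : curvature D Γ b a = -(h * (curvature D Γ b a).transpose * g) := by
      have hhg : h * g = 1 := mul_eq_one_comm.mp hgh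
      have := congrArg (h * ·) (transpose_curvature_mul hD hg b a)
      simp only [mul_add, mul_zero, ← mul_assoc, hhg, one_mul] at this
      exact eq_neg_of_add_eq_zero_right this
    have h2 : (curvature D Γ b a).trace = -(curvature D Γ b a).trace := by
      conv_lhs => rw [h1, Matrix.trace_neg, Matrix.trace_mul_cycle, hgh, one_mul,
        Matrix.trace_transpose]
    have h3 : (2 : ℂ) • (curvature D Γ b a).trace = 0 := by
      rw [two_smul]; nth_rewrite 1 [h2]; simp
    have h4 := congrArg ((1 / 2 : ℂ) • ·) h3
    simp only [smul_smul, smul_zero] at h4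
    norm_num at h4
    exact h4
  have hsum : ∑ c, (curvature D Γ a c c b + curvature D Γ c b c a + curvature D Γ b a c c) = 0 :=
    Finset.sum_eq_zero fun c _ => first_bianchi hΓ a c c b
  rw [Finset.sum_add_distrib, Finset.sum_add_distrib, htr, add_zero] at hsum
  rw [connRicci, eq_neg_of_add_eq_zero_left hsum, connRicci, ← Finset.sum_neg_distrib]
  exact Finset.sum_congr rfl fun c _ => by rw [curvature_antisymm b c]; simp

theorem derivation_trace {g h : Matrix ι ι A} (hgh : g * h = 1)
    (hg : ∀ a, g.map (D a) = (Γ a).transpose * g + g * Γ a) (T : ι → ι → A) (a : ι) :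
    D a (∑ b, ∑ c, h b c * T b c) = ∑ b, ∑ c, h b c * connDeriv₂ D Γ T a b c := by
  have hh : ∀ b c, D a (h b c) = -(∑ e, Γ a b e * h e c + ∑ e, h b e * Γ a c e) := by
    intro b c
    have := congrFun₂ (map_inverse_of_compatible hgh hg a) b c
    simpa [Matrix.mul_apply] using this
  have s1 : ∑ b, ∑ c, ∑ e, h b c * (Γ a e b * T e c) = ∑ b, ∑ c, ∑ e, T b c * (Γ a b e * h e c) := by
    rw [Finset.sum_comm' (t' := Finset.univ) (s' := fun _ => Finset.univ) (by simp)]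
    conv_rhs => rw [Finset.sum_comm]
    refine Finset.sum_congr rfl fun c _ => ?_
    rw [Finset.sum_comm]
    exact Finset.sum_congr rfl fun _ _ => Finset.sum_congr rfl fun _ _ => by ring
  have s2 : ∑ b, ∑ c, ∑ e, h b c * (Γ a e c * T b e) = ∑ b, ∑ c, ∑ e, T b c * (h b e * Γ a c e) := by
    refine Finset.sum_congr rfl fun b _ => ?_
    rw [Finset.sum_comm]
    exact Finset.sum_congr rfl fun _ _ => Finset.sum_congr rfl fun _ _ => by ring
  simp only [connDeriv₂, map_sum, Derivation.leibniz, smul_eq_mul, hh, mul_sub, mul_add, mul_neg,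
    Finset.mul_sum, Finset.sum_add_distrib, Finset.sum_sub_distrib, Finset.sum_neg_distrib]
  rw [s1, s2]
  ring

/-- The contracted Bianchi identity `2 ∇^e R_{ae} = ∇_a R`. -/
theorem contracted_bianchi (hD : ∀ i j x, D i (D j x) = D j (D i x))
    (hΓ : ∀ a b c, Γ a c b = Γ b c a) {g h : Matrix ι ι A} (hsymm : ∀ a b, h a b = h b a)
    (hgh : g * h = 1) (hg : ∀ a, g.map (D a) = (Γ a).transpose * g + g * Γ a) (a : ι) :
    2 * ∑ e, ∑ b, h e b * connDeriv₂ D Γ (connRicci D Γ) e a b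
      = D a (∑ e, ∑ b, h e b * connRicci D Γ e b) := by
  -- The second Bianchi identity with one derivative or form index contracted against the upper
  -- index.
  have h1 : ∀ e b, connDeriv₂ D Γ (connRicci D Γ) e a b - connDeriv₂ D Γ (connRicci D Γ) a e b
      + ∑ c, covCurvature D Γ c e a c b = 0 := by
    intro e b
    rw [connDeriv₂_connRicci, connDeriv₂_connRicci, ← Finset.sum_sub_distrib,
      ← Finset.sum_add_distrib]
    refine Finset.sum_eq_zero fun c _ => ?_
    have := congrFun₂ (second_bianchi hD hΓ e a c) c b
    rw [covCurvature_antisymm a e c] at this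
    simpa [sub_eq_add_neg] using this
  -- Skewness in the endomorphism indices and in the form indices makes the remaining trace a second
  -- copy of the Ricci divergence, whence the factor 2.
  have h2 : ∑ e, ∑ b, h e b * ∑ c, covCurvature D Γ c e a c b
      = ∑ e, ∑ b, h e b * connDeriv₂ D Γ (connRicci D Γ) e a b := by
    have s1 : ∑ e, ∑ b, h e b * ∑ c, covCurvature D Γ c e a c b
        = ∑ e, ∑ c, (covCurvature D Γ c e a * h) c e := by
      refine Finset.sum_congr rfl fun e _ => ?_
      simp only [Matrix.mul_apply, Finset.mul_sum]
      rw [Finset.sum_comm]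
      exact Finset.sum_congr rfl fun _ _ => Finset.sum_congr rfl fun b _ => by
        rw [hsymm e b, mul_comm]
    have s2 : ∀ e c, (covCurvature D Γ c e a * h) c e
        = ∑ d, h c d * covCurvature D Γ c a e e d := by
      intro e c
      rw [eq_neg_of_add_eq_zero_left (covCurvature_mul_add hD hgh hg c e a),
        covCurvature_antisymm c a e]
      simp [Matrix.mul_apply]
    rw [s1]
    simp only [s2, connDeriv₂_connRicci, Finset.mul_sum]
    rw [Finset.sum_comm]
    exact Finset.sum_congr rfl fun c _ => Finset.sum_comm
  have h3 : ∑ e, ∑ b, h e b * (connDeriv₂ D Γ (connRicci D Γ) e a b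
      - connDeriv₂ D Γ (connRicci D Γ) a e b + ∑ c, covCurvature D Γ c e a c b) = 0 := by
    simp [h1]
  simp only [mul_add, mul_sub, Finset.sum_add_distrib, Finset.sum_sub_distrib] at h3
  rw [derivation_trace hgh hg]
  rw [h2] at h3
  linear_combination h3

/-- Lowering the upper index gives the Christoffel symbols of the first kind; adding the transpose
cancels every term except `D a (g b c)`. -/
theorem leviCivita_compatible {g h : Matrix ι ι A} (hsymm : ∀ a b, g a b = g b a)
    (hgh : g * h = 1) (a : ι) :
    g.map (D a) = (leviCivita D g h a).transpose * g + g * leviCivita D g h a := by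
  have key : ∀ c b, (g * leviCivita D g h a) c b
      = (1 / 2 : ℂ) • (D a (g b c) + D b (g a c) - D c (g a b)) := by
    intro c b
    simp only [Matrix.mul_apply, leviCivita, Matrix.of_apply, mul_smul_comm, ← Finset.smul_sum,
      Finset.mul_sum]
    rw [Finset.sum_comm]
    congr 1
    have : ∀ l, ∑ e, g c e * (h e l * (D a (g b l) + D b (g a l) - D l (g a b)))
        = (1 : Matrix ι ι A) c l * (D a (g b l) + D b (g a l) - D l (g a b)) := by
      intro l
      rw [← hgh, Matrix.mul_apply, Finset.sum_mul]
      exact Finset.sum_congr rfl fun _ _ => by ring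
    simp [this, Matrix.one_apply]
  have ht : (leviCivita D g h a).transpose * g = (g * leviCivita D g h a).transpose := by
    rw [Matrix.transpose_mul]
    congr 1
    ext i j; exact hsymm i j
  ext b c
  rw [ht, Matrix.add_apply, Matrix.transpose_apply, key, key, Matrix.map_apply, ← smul_add,
    hsymm c b]
  have : D a (g b c) + D b (g a c) - D c (g a b) + (D a (g b c) + D c (g a b) - D b (g a c))
      = (2 : ℂ) • D a (g b c) := by rw [two_smul]; ring
  rw [this, smul_smul]
  norm_num

end DerivationCalculus

/-! ### Smooth functions on an open coordinate set as a differential algebra. -/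

section SmoothFunctions

/-- The algebra of smooth complex-valued functions on a subset of coordinate space. -/
def smoothAlgebra (V : Set E3) : Subalgebra ℂ (V → ℂ) where
  carrier := {f | ∃ F : E3 → ℂ, ContDiffOn ℝ ∞ F V ∧ ∀ x : V, f x = F x}
  mul_mem' := by
    rintro f g ⟨F, hF, hf⟩ ⟨K, hK, hg⟩
    exact ⟨fun x => F x * K x, hF.mul hK, fun x => by simp [hf, hg]⟩
  add_mem' := by
    rintro f g ⟨F, hF, hf⟩ ⟨K, hK, hg⟩
    exact ⟨fun x => F x + K x, hF.add hK, fun x => by simp [hf, hg]⟩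
  algebraMap_mem' r := ⟨fun _ => r, contDiffOn_const, fun _ => rfl⟩

variable {V : Set E3}

/-- Evaluation at a point. -/
def evalAt (x : V) : smoothAlgebra V →ₐ[ℂ] ℂ :=
  (Pi.evalAlgHom ℂ (fun _ : V => ℂ) x).comp (smoothAlgebra V).val

theorem smoothAlgebra_ext {f g : smoothAlgebra V} (h : ∀ x, evalAt x f = evalAt x g) : f = g :=
  Subtype.ext (funext h)

/-- A function smooth on `V` as an element of the algebra. -/
def ofContDiffOn (F : E3 → ℂ) (hF : ContDiffOn ℝ ∞ F V) : smoothAlgebra V :=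
  ⟨fun x => F x, F, hF, fun _ => rfl⟩

@[simp] theorem evalAt_ofContDiffOn (F : E3 → ℂ) (hF : ContDiffOn ℝ ∞ F V) (x : V) :
    evalAt x (ofContDiffOn F hF) = F x := rfl

/-- The function `F` restricts on `V` to the element `f` of the algebra. -/
def Represents (f : smoothAlgebra V) (F : E3 → ℂ) : Prop := ∀ x : V, evalAt x f = F x

theorem exists_represents (f : smoothAlgebra V) :
    ∃ F : E3 → ℂ, ContDiffOn ℝ ∞ F V ∧ Represents f F := f.2

/-- Openness of `V` means that equality on `V` is equality of germs. This makes `partialD`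
independent of the chosen extension to `E3`. -/
theorem pd_congr (hV : IsOpen V) {F K : E3 → ℂ} (h : ∀ x : V, F x = K x) (i : Fin 3) (x : V) :
    pd i F x = pd i K x := by
  have : F =ᶠ[𝓝 (x : E3)] K :=
    Filter.eventuallyEq_of_mem (hV.mem_nhds x.2) fun y hy => h ⟨y, hy⟩
  simp only [pd, this.fderiv_eq]

theorem contDiffOn_pd (hV : IsOpen V) {F : E3 → ℂ} (hF : ContDiffOn ℝ ∞ F V) (i : Fin 3) :
    ContDiffOn ℝ ∞ (pd i F) V :=
  (hF.fderiv_of_isOpen hV (by simp)).clm_apply contDiffOn_const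

theorem differentiableAt_of_contDiffOn (hV : IsOpen V) {F : E3 → ℂ} (hF : ContDiffOn ℝ ∞ F V)
    (x : V) : DifferentiableAt ℝ F x :=
  (hF.contDiffAt (hV.mem_nhds x.2)).differentiableAt (by simp)

theorem pd_comm (hV : IsOpen V) {F : E3 → ℂ} (hF : ContDiffOn ℝ ∞ F V) (i j : Fin 3) (x : V) :
    pd i (pd j F) x = pd j (pd i F) x := by
  have hd : DifferentiableAt ℝ (fderiv ℝ F) x :=
    ((hF.fderiv_of_isOpen hV (m := ∞) (by simp)).contDiffAt (hV.mem_nhds x.2)).differentiableAt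
      (by simp)
  have hs : IsSymmSndFDerivAt ℝ F x :=
    (hF.contDiffAt (hV.mem_nhds x.2)).isSymmSndFDerivAt
      (by simpa using mod_cast ENat.LEInfty.out)
  have key : ∀ i j, pd i (pd j F) x
      = fderiv ℝ (fderiv ℝ F) x (EuclideanSpace.single i 1) (EuclideanSpace.single j 1) := by
    intro i j
    change fderiv ℝ (fun y => fderiv ℝ F y (EuclideanSpace.single j 1)) x _ = _
    rw [fderiv_clm_apply hd (differentiableAt_const _)]
    simp
  rw [key, key]
  exact hs _ _

/-- The partial derivatives as derivations of the algebra of smooth functions. -/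
def partialD (hV : IsOpen V) (i : Fin 3) : Derivation ℂ (smoothAlgebra V) (smoothAlgebra V) where
  toFun f := ofContDiffOn _ (contDiffOn_pd hV (exists_represents f).choose_spec.1 i)
  map_add' f g := by
    refine smoothAlgebra_ext fun x => ?_
    rw [map_add]
    simp only [evalAt_ofContDiffOn]
    obtain ⟨hf, hf'⟩ := (exists_represents f).choose_spec
    obtain ⟨hg, hg'⟩ := (exists_represents g).choose_spec
    obtain ⟨-, h'⟩ := (exists_represents (f + g)).choose_spec
    rw [pd_congr hV (K := (exists_represents f).choose + (exists_represents g).choose)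
      (fun y => by rw [← h', map_add, Pi.add_apply, ← hf', ← hg'])]
    simp only [pd]
    rw [fderiv_add (differentiableAt_of_contDiffOn hV hf x)
      (differentiableAt_of_contDiffOn hV hg x)]
    rfl
  map_smul' r f := by
    refine smoothAlgebra_ext fun x => ?_
    rw [RingHom.id_apply, map_smul]
    simp only [evalAt_ofContDiffOn]
    obtain ⟨hf, hf'⟩ := (exists_represents f).choose_spec
    obtain ⟨-, h'⟩ := (exists_represents (r • f)).choose_spec
    rw [pd_congr hV (K := r • (exists_represents f).choose)
      (fun y => by rw [← h', map_smul, Pi.smul_apply, ← hf'])]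
    simp only [pd]
    rw [fderiv_const_smul (differentiableAt_of_contDiffOn hV hf x)]
    rfl
  map_one_eq_zero' := by
    refine smoothAlgebra_ext fun x => ?_
    obtain ⟨-, h'⟩ := (exists_represents (1 : smoothAlgebra V)).choose_spec
    change pd i _ (x : E3) = 0
    rw [pd_congr hV (K := fun _ => 1) (fun y => by rw [← h', map_one])]
    simp [pd]
  leibniz' f g := by
    refine smoothAlgebra_ext fun x => ?_
    rw [map_add, smul_eq_mul, smul_eq_mul]
    obtain ⟨hf, hf'⟩ := (exists_represents f).choose_spec
    obtain ⟨hg, hg'⟩ := (exists_represents g).choose_spec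
    obtain ⟨-, h'⟩ := (exists_represents (f * g)).choose_spec
    change pd i _ (x : E3) = evalAt x f * pd i _ (x : E3) + evalAt x g * pd i _ (x : E3)
    rw [pd_congr hV (K := (exists_represents f).choose * (exists_represents g).choose)
      (fun y => by rw [← h', map_mul, Pi.mul_apply, ← hf', ← hg'])]
    simp only [pd]
    rw [fderiv_mul (differentiableAt_of_contDiffOn hV hf x)
      (differentiableAt_of_contDiffOn hV hg x), hf', hg']
    rfl

theorem Represents.partialD (hV : IsOpen V) {f : smoothAlgebra V} {F : E3 → ℂ}
    (h : Represents f F) (i : Fin 3) : Represents (partialD hV i f) (pd i F) := fun x => by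
  obtain ⟨-, hf'⟩ := (exists_represents f).choose_spec
  exact pd_congr hV (fun y => by rw [← hf', h]) i x

theorem partialD_comm (hV : IsOpen V) (i j : Fin 3) (f : smoothAlgebra V) :
    NullGeometry.partialD hV i (NullGeometry.partialD hV j f)
      = NullGeometry.partialD hV j (NullGeometry.partialD hV i f) := by
  obtain ⟨F, hF, h⟩ := exists_represents f
  refine smoothAlgebra_ext fun x => ?_
  rw [(h.partialD hV j).partialD hV i x, (h.partialD hV i).partialD hV j x, pd_comm hV hF]

/-- Applied to the determinant, this makes a pointwise nondegenerate metric invertible over the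
algebra. -/
theorem isUnit_of_evalAt_ne_zero {f : smoothAlgebra V} (h : ∀ x, evalAt x f ≠ 0) : IsUnit f := by
  obtain ⟨F, hF, hf⟩ := exists_represents f
  have hF0 : ∀ x ∈ V, F x ≠ 0 := fun x hx => by
    have := h ⟨x, hx⟩
    rwa [hf] at this
  refine IsUnit.of_mul_eq_one (ofContDiffOn (fun x => (F x)⁻¹) (hF.inv hF0))
    (smoothAlgebra_ext fun x => ?_)
  rw [map_mul, hf, evalAt_ofContDiffOn, map_one, mul_inv_cancel₀ (hF0 x x.2)]

end SmoothFunctions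

/-! ### Coordinate tensors as evaluations of the algebraic ones. -/

section CoordinateMetric

/-- A smooth nondegenerate complex metric on an open set of coordinate space. -/
structure IsCoordMetric (G : E3 → Matrix (Fin 3) (Fin 3) ℂ) (V : Set E3) : Prop where
  isOpen : IsOpen V
  smooth : ∀ i j, ContDiffOn ℝ ∞ (fun x => G x i j) V
  symm : ∀ x ∈ V, ∀ i j, G x i j = G x j i
  det_ne_zero : ∀ x ∈ V, (G x).det ≠ 0

namespace IsCoordMetric

variable {G : E3 → Matrix (Fin 3) (Fin 3) ℂ} {V : Set E3} (hG : IsCoordMetric G V)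
include hG

/-- The metric as a matrix over the algebra of smooth functions. -/
def metric : Matrix (Fin 3) (Fin 3) (smoothAlgebra V) :=
  Matrix.of fun i j => ofContDiffOn (fun x => G x i j) (hG.smooth i j)

theorem represents_metric (i j : Fin 3) : Represents (hG.metric i j) (fun x => G x i j) :=
  fun _ => rfl

theorem metric_symm (i j : Fin 3) : hG.metric i j = hG.metric j i :=
  smoothAlgebra_ext fun x => hG.symm x x.2 i j

theorem map_metric (x : V) : (evalAt x).mapMatrix hG.metric = G x := rfl

theorem metric_mul_inv : hG.metric * hG.metric⁻¹ = 1 := by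
  refine Matrix.mul_nonsing_inv _ (isUnit_of_evalAt_ne_zero fun x => ?_)
  rw [AlgHom.map_det, hG.map_metric]
  exact hG.det_ne_zero x x.2

theorem represents_inv (i j : Fin 3) :
    Represents (hG.metric⁻¹ i j) (fun x => (G x)⁻¹ i j) := fun x => by
  have h : (evalAt x).mapMatrix (hG.metric * hG.metric⁻¹) = 1 := by rw [hG.metric_mul_inv, map_one]
  rw [map_mul, hG.map_metric] at h
  change _ = (G x)⁻¹ i j
  rw [Matrix.inv_eq_right_inv h]
  rfl

theorem inv_symm (i j : Fin 3) : hG.metric⁻¹ i j = hG.metric⁻¹ j i := by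
  have : hG.metric.transpose = hG.metric := by ext1 i j; exact hG.metric_symm j i
  conv_lhs => rw [← this, ← Matrix.transpose_nonsing_inv]
  rfl

/-- The Levi-Civita connection matrices over the algebra of smooth functions. -/
def conn : Fin 3 → Matrix (Fin 3) (Fin 3) (smoothAlgebra V) :=
  leviCivita (partialD hG.isOpen) hG.metric hG.metric⁻¹

theorem conn_torsionFree (a b c : Fin 3) : hG.conn a c b = hG.conn b c a :=
  leviCivita_torsionFree hG.metric_symm a b c

theorem conn_compatible (a : Fin 3) :
    hG.metric.map (partialD hG.isOpen a)
      = (hG.conn a).transpose * hG.metric + hG.metric * hG.conn a :=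
  leviCivita_compatible hG.metric_symm hG.metric_mul_inv a

theorem represents_conn (i k j : Fin 3) :
    Represents (hG.conn i k j) (christoffel G k i j) := fun x => by
  simp only [conn, leviCivita, christoffel, Matrix.of_apply, map_smul, smul_eq_mul, map_sum,
    map_mul, map_sub, map_add, hG.represents_inv _ _ x,
    (hG.represents_metric _ _).partialD hG.isOpen _ x]

theorem represents_curvature (a b c d : Fin 3) :
    Represents (curvature (partialD hG.isOpen) hG.conn a b c d) (riemann G a b d c) := fun x => by
  simp only [curvature, riemann, Matrix.add_apply, Matrix.sub_apply, Matrix.map_apply,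
    Matrix.mul_apply, map_sub, map_add, map_sum, map_mul, hG.represents_conn _ _ _ x,
    (hG.represents_conn _ _ _).partialD hG.isOpen _ x, Finset.sum_sub_distrib]

theorem represents_ricci (a b : Fin 3) :
    Represents (connRicci (partialD hG.isOpen) hG.conn a b) (ricci G a b) := fun x => by
  simp only [connRicci, ricci, map_sum, hG.represents_curvature _ _ _ _ x]

/-- The Ricci scalar over the algebra of smooth functions. -/
def scalar : smoothAlgebra V :=
  ∑ a, ∑ b, hG.metric⁻¹ a b * connRicci (partialD hG.isOpen) hG.conn a b

theorem represents_scalar : Represents hG.scalar (ricciScalar G) := fun x => by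
  simp only [scalar, ricciScalar, map_sum, map_mul, hG.represents_ricci _ _ x,
    hG.represents_inv _ _ x]

theorem represents_scalarS : Represents ((1 / 12 : ℂ) • hG.scalar) (scalarS G) := fun x => by
  rw [map_smul, hG.represents_scalar x]; rfl

/-- The tracefree Ricci tensor over the algebra of smooth functions. -/
def tracefree (a b : Fin 3) : smoothAlgebra V :=
  connRicci (partialD hG.isOpen) hG.conn a b - ((1 / 3 : ℂ) • hG.scalar) * hG.metric a b

theorem represents_tracefree (a b : Fin 3) :
    Represents (hG.tracefree a b) (tracefreeRicci G a b) := fun x => by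
  simp only [tracefree, tracefreeRicci, map_sub, map_mul, map_smul, hG.represents_ricci _ _ x,
    hG.represents_scalar x, hG.represents_metric _ _ x, smul_eq_mul]

theorem represents_connDeriv₂ {T : Fin 3 → Fin 3 → smoothAlgebra V} {F : Fin 3 → Fin 3 → E3 → ℂ}
    (h : ∀ a b, Represents (T a b) (F a b)) (a b c : Fin 3) :
    Represents (connDeriv₂ (partialD hG.isOpen) hG.conn T a b c) (covDeriv₂ G F a b c) :=
  fun x => by
  simp only [connDeriv₂, covDeriv₂, map_sub, map_sum, map_add, map_mul,
    (h _ _).partialD hG.isOpen _ x, hG.represents_conn _ _ _ x, h _ _ x]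

theorem tracefree_symm (a b : Fin 3) : hG.tracefree a b = hG.tracefree b a := by
  simp only [tracefree, hG.metric_symm a b, connRicci_symm (partialD_comm hG.isOpen)
    hG.conn_torsionFree hG.metric_mul_inv hG.conn_compatible a b]

theorem tracefreeRicci_symm {x : E3} (hx : x ∈ V) (a b : Fin 3) :
    tracefreeRicci G a b x = tracefreeRicci G b a x := by
  rw [← hG.represents_tracefree a b ⟨x, hx⟩, hG.tracefree_symm, hG.represents_tracefree b a ⟨x, hx⟩]

theorem sum_inv_mul_metric {x : E3} (hx : x ∈ V) : ∑ a, ∑ b, (G x)⁻¹ a b * G x a b = 3 := by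
  have h : ((G x)⁻¹ * G x).trace = 3 := by
    rw [Matrix.nonsing_inv_mul _ (hG.det_ne_zero x hx).isUnit]; simp
  rw [← h]
  simp only [Matrix.trace, Matrix.diag_apply, Matrix.mul_apply]
  refine Finset.sum_congr rfl fun a _ => Finset.sum_congr rfl fun b _ => ?_
  rw [hG.symm x hx]

theorem trace_tracefreeRicci {x : E3} (hx : x ∈ V) :
    ∑ a, ∑ b, (G x)⁻¹ a b * tracefreeRicci G a b x = 0 := by
  have h : ∀ a b, (G x)⁻¹ a b * tracefreeRicci G a b x = (G x)⁻¹ a b * ricci G a b x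
      - 1 / 3 * ricciScalar G x * ((G x)⁻¹ a b * G x a b) := fun a b => by
    simp only [tracefreeRicci]; ring
  simp only [h, Finset.sum_sub_distrib, ← Finset.mul_sum, hG.sum_inv_mul_metric hx]
  rw [ricciScalar]; ring

theorem connDeriv₂_tracefree (a b c : Fin 3) :
    connDeriv₂ (partialD hG.isOpen) hG.conn hG.tracefree a b c
      = connDeriv₂ (partialD hG.isOpen) hG.conn (connRicci (partialD hG.isOpen) hG.conn) a b c
        - partialD hG.isOpen a ((1 / 3 : ℂ) • hG.scalar) * hG.metric b c :=
  connDeriv₂_sub_smul_metric hG.conn_compatible _ _ a b c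

theorem covDeriv₂_tracefreeRicci_symm {x : E3} (hx : x ∈ V) (a b c : Fin 3) :
    covDeriv₂ G (tracefreeRicci G) a b c x = covDeriv₂ G (tracefreeRicci G) a c b x := by
  rw [← hG.represents_connDeriv₂ hG.represents_tracefree a b c ⟨x, hx⟩,
    ← hG.represents_connDeriv₂ hG.represents_tracefree a c b ⟨x, hx⟩]
  simp only [connDeriv₂, hG.tracefree_symm b, hG.tracefree_symm _ c, add_comm]

/-- The contracted Bianchi identity `∇^eΦ_{ae} = 2 ∇_a S`. -/
theorem divergence_tracefreeRicci {x : E3} (hx : x ∈ V) (a : Fin 3) :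
    ∑ e, ∑ b, (G x)⁻¹ e b * covDeriv₂ G (tracefreeRicci G) e a b x = 2 * pd a (scalarS G) x := by
  have h := congrArg (evalAt ⟨x, hx⟩) (contracted_bianchi (partialD_comm hG.isOpen)
    hG.conn_torsionFree hG.inv_symm hG.metric_mul_inv hG.conn_compatible a)
  change evalAt ⟨x, hx⟩ _ = evalAt ⟨x, hx⟩ (partialD hG.isOpen a hG.scalar) at h
  have hS : pd a (scalarS G) x = 1 / 12 * evalAt ⟨x, hx⟩ (partialD hG.isOpen a hG.scalar) := by
    rw [← hG.represents_scalarS.partialD hG.isOpen a ⟨x, hx⟩, Derivation.map_smul,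
      map_smul, smul_eq_mul]
  have hinv : ∀ e b, evalAt ⟨x, hx⟩ (hG.metric⁻¹ e b) = (G x)⁻¹ e b := fun e b =>
    hG.represents_inv e b ⟨x, hx⟩
  have hmet : ∀ e b, evalAt ⟨x, hx⟩ (hG.metric e b) = G x e b := fun _ _ => rfl
  have hd : ∀ e b, (G x)⁻¹ e b * covDeriv₂ G (tracefreeRicci G) e a b x
      = evalAt ⟨x, hx⟩ (hG.metric⁻¹ e b * connDeriv₂ (partialD hG.isOpen) hG.conn
          (connRicci (partialD hG.isOpen) hG.conn) e a b)
        - 1 / 3 * ((G x)⁻¹ b e * G x a b) * evalAt ⟨x, hx⟩ (partialD hG.isOpen e hG.scalar) := by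
    intro e b
    rw [← hG.represents_connDeriv₂ hG.represents_tracefree e a b ⟨x, hx⟩, hG.connDeriv₂_tracefree,
      map_sub, map_mul, map_mul, Derivation.map_smul, map_smul, hmet, ← hinv b e, ← hinv e b,
      hG.inv_symm b e, smul_eq_mul]
    ring
  have h1 : ∀ e, ∑ b, (G x)⁻¹ b e * G x a b = (1 : Matrix (Fin 3) (Fin 3) ℂ) a e := by
    intro e
    rw [← Matrix.mul_nonsing_inv _ (hG.det_ne_zero x hx).isUnit, Matrix.mul_apply]
    exact Finset.sum_congr rfl fun _ _ => mul_comm _ _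
  have h2 : ∑ e, ∑ b, 1 / 3 * ((G x)⁻¹ b e * G x a b)
      * evalAt ⟨x, hx⟩ (partialD hG.isOpen e hG.scalar)
      = 1 / 3 * evalAt ⟨x, hx⟩ (partialD hG.isOpen a hG.scalar) := by
    simp only [← Finset.sum_mul, ← Finset.mul_sum, h1]
    simp [Matrix.one_apply]
  simp only [hd, Finset.sum_sub_distrib, h2, hS]
  rw [map_mul] at h
  simp only [map_sum] at h
  rw [show evalAt (⟨x, hx⟩ : V) 2 = 2 from map_ofNat _ 2] at h
  -- The Ricci divergence is half the gradient of `R`, and removing the trace subtracts a third; the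
  -- remaining sixth is `2 ∇S`, as `S = R / 12`.
  linear_combination (1 / 2) * h

/-- The Schouten tensor is `-Φ - S g` and `g` is parallel, so only `∇Φ` and the gradient of `S`
survive. -/
theorem cotton_eq {x : E3} (hx : x ∈ V) (a b c : Fin 3) :
    cotton G a b c x = -covDeriv₂ G (tracefreeRicci G) b c a x
      + covDeriv₂ G (tracefreeRicci G) c b a x
      - G x c a * pd b (scalarS G) x + G x b a * pd c (scalarS G) x := by
  have hP : ∀ a b, Represents (-hG.tracefree a b - ((1 / 12 : ℂ) • hG.scalar) * hG.metric a b)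
      (schouten G a b) := fun a b y => by
    simp only [schouten, map_sub, map_neg, map_mul, map_smul, hG.represents_tracefree _ _ y,
      hG.represents_scalar y, hG.represents_metric _ _ y, smul_eq_mul]
  have hc : ∀ a b c, covDeriv₂ G (schouten G) a b c x
      = -covDeriv₂ G (tracefreeRicci G) a b c x - pd a (scalarS G) x * G x b c := by
    intro a b c
    rw [← hG.represents_connDeriv₂ hP a b c ⟨x, hx⟩,
      connDeriv₂_sub_smul_metric hG.conn_compatible, connDeriv₂_neg, map_sub, map_neg, map_mul,
      hG.represents_connDeriv₂ hG.represents_tracefree a b c ⟨x, hx⟩,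
      hG.represents_scalarS.partialD hG.isOpen a ⟨x, hx⟩, hG.represents_metric b c ⟨x, hx⟩]
  rw [cotton, hc, hc]
  ring

/-- The covariant derivative `∇_b Y^a` in coordinates. -/
def _root_.NullGeometry.covDerivComp (G : E3 → Matrix (Fin 3) (Fin 3) ℂ) (Y : Fin 3 → E3 → ℂ)
    (b a : Fin 3) (x : E3) : ℂ :=
  pd b (Y a) x + ∑ j, christoffel G a b j x * Y j x

theorem represents_connDerivVec {T : Fin 3 → smoothAlgebra V} {Y : Fin 3 → E3 → ℂ}
    (h : ∀ a, Represents (T a) (Y a)) (b a : Fin 3) :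
    Represents (connDerivVec (partialD hG.isOpen) hG.conn T b a) (covDerivComp G Y b a) :=
  fun x => by
  simp only [connDerivVec, covDerivComp, map_add, map_sum, map_mul,
    (h _).partialD hG.isOpen _ x, hG.represents_conn _ _ _ x, h _ x]

/-- Proportionality of the covectors `Φk` and `gk` is expressed by minors, so only `k` has to be
smooth; the eigenvalue and the rest of the frame may be chosen pointwise. -/
theorem covDeriv_eigenvector {k : Fin 3 → E3 → ℂ} (hk : ∀ a, ContDiffOn ℝ ∞ (k a) V)
    (h : ∀ x ∈ V, ∀ a d, (∑ c, tracefreeRicci G a c x * k c x) * (∑ c, G x d c * k c x)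
      = (∑ c, tracefreeRicci G d c x * k c x) * (∑ c, G x a c * k c x))
    {x : E3} (hx : x ∈ V) (b a d : Fin 3) :
    (∑ c, covDeriv₂ G (tracefreeRicci G) b a c x * k c x
        + ∑ c, tracefreeRicci G a c x * covDerivComp G k b c x) * (∑ c, G x d c * k c x)
      + (∑ c, tracefreeRicci G a c x * k c x) * (∑ c, G x d c * covDerivComp G k b c x)
    = (∑ c, covDeriv₂ G (tracefreeRicci G) b d c x * k c x
        + ∑ c, tracefreeRicci G d c x * covDerivComp G k b c x) * (∑ c, G x a c * k c x)
      + (∑ c, tracefreeRicci G d c x * k c x) * (∑ c, G x a c * covDerivComp G k b c x) := by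
  have hK : ∀ a, Represents (ofContDiffOn (k a) (hk a)) (k a) := fun a x => rfl
  have := congrArg (evalAt ⟨x, hx⟩) (derivation_eigenvector hG.conn_compatible hG.tracefree
    (fun a => ofContDiffOn (k a) (hk a)) (fun a d => smoothAlgebra_ext fun y => by
      simp only [map_mul, map_sum, hG.represents_tracefree _ _ y, hK _ y,
        hG.represents_metric _ _ y]
      exact h y y.2 a d) b a d)
  simp only [map_mul, map_sum, map_add, hG.represents_tracefree _ _ ⟨x, hx⟩, hK _ ⟨x, hx⟩,
    hG.represents_metric _ _ ⟨x, hx⟩, hG.represents_connDerivVec hK _ _ ⟨x, hx⟩,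
    hG.represents_connDeriv₂ hG.represents_tracefree _ _ _ ⟨x, hx⟩] at this
  exact this

theorem covDeriv_orthogonal {k Y : Fin 3 → E3 → ℂ} (hk : ∀ a, ContDiffOn ℝ ∞ (k a) V)
    (hY : ∀ a, ContDiffOn ℝ ∞ (Y a) V)
    (h : ∀ x ∈ V, ∑ a, (∑ c, G x a c * k c x) * Y a x = 0) {x : E3} (hx : x ∈ V) (b : Fin 3) :
    ∑ a, (∑ c, G x a c * covDerivComp G k b c x) * Y a x
      + ∑ a, (∑ c, G x a c * k c x) * covDerivComp G Y b a x = 0 := by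
  have hK : ∀ a, Represents (ofContDiffOn (k a) (hk a)) (k a) := fun a x => rfl
  have hL : ∀ a, Represents (ofContDiffOn (Y a) (hY a)) (Y a) := fun a x => rfl
  have := congrArg (evalAt ⟨x, hx⟩) (derivation_orthogonal hG.conn_compatible
    (fun a => ofContDiffOn (k a) (hk a)) (fun a => ofContDiffOn (Y a) (hY a))
    (smoothAlgebra_ext fun y => by
      simp only [map_mul, map_sum, hL _ y, hK _ y, hG.represents_metric _ _ y, map_zero]
      exact h y y.2) b)
  simp only [map_mul, map_sum, map_add, hK _ ⟨x, hx⟩, hL _ ⟨x, hx⟩, map_zero,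
    hG.represents_metric _ _ ⟨x, hx⟩, hG.represents_connDerivVec hK _ _ ⟨x, hx⟩,
    hG.represents_connDerivVec hL _ _ ⟨x, hx⟩] at this
  exact this

end IsCoordMetric

end CoordinateMetric

/-! ### Null frames and the type D normal form. -/

section Algebra

variable {V : Type*} [AddCommGroup V] [Module ℂ V]

namespace IsAdaptedFrame

variable {B : LinearMap.BilinForm ℂ V} {k l n : V}

/-- Expansion of a vector in an adapted frame of a 3-dimensional space. -/
theorem decomp (h : IsAdaptedFrame B k l n) (hs : ∀ u v, B u v = B v u)
    (hV : Module.finrank ℂ V = 3) (v : V) :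
    v = B v l • k + B v k • l - (2 * B v n) • n := by
  have hlk : B l k = 1 := by rw [hs, h.kl]
  have hnk : B n k = 0 := by rw [hs, h.kn]
  have hnl : B n l = 0 := by rw [hs, h.ln]
  have hli : LinearIndependent ℂ ![k, l, n] := by
    rw [Fintype.linearIndependent_iff]
    intro c hc
    simp only [Fin.sum_univ_three, Matrix.cons_val_zero, Matrix.cons_val_one,
      Matrix.cons_val_two] at hc
    have hk := congrArg (B k) hc
    have hl := congrArg (B l) hc
    have hn := congrArg (B n) hc
    simp [h.kk, h.kl, h.kn] at hk
    simp [h.ll, hlk, h.ln] at hl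
    simp [h.nn, hnk, hnl] at hn
    intro i; fin_cases i <;> simp [hk, hl, hn]
  have : Module.Finite ℂ V := Module.finite_of_finrank_pos (by omega)
  have htop := hli.span_eq_top_of_card_eq_finrank (by simp [hV])
  have hv : v ∈ Submodule.span ℂ (Set.range ![k, l, n]) := by rw [htop]; trivial
  obtain ⟨c, rfl⟩ := (Submodule.mem_span_range_iff_exists_fun ℂ).mp hv
  simp [Fin.sum_univ_three, h.kk, h.kl, h.kn, h.ll, h.ln, h.nn, hlk, hnk, hnl]
  module

end IsAdaptedFrame

variable {B Φ : LinearMap.BilinForm ℂ V}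

theorem IsAdaptedFrame.smul_line {k k' l n : V} (h : IsAdaptedFrame B k' l n) {c : ℂ} (hc : c ≠ 0)
    (hk : k' = c • k) : IsAdaptedFrame B k (c • l) n := by
  subst hk
  have h1 := h.kk; have h2 := h.ll; have h3 := h.kl; have h4 := h.kn; have h5 := h.ln
  simp only [map_smul, LinearMap.smul_apply, smul_eq_mul] at h1 h3 h4
  refine ⟨?_, ?_, ?_, ?_, ?_, h.nn⟩
  · simpa [hc] using h1
  · simp [h2]
  · simpa using h3
  · simpa [hc] using h4
  · simp [h5]

/-- A double root at 0 kills the two lowest coefficients of the quartic, which are `Φ k k / 2` and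
`2 Φ k n`. Rescaling `k` against `l` allows any prescribed generator. -/
theorem HasPrincipalMultiplicity.exists_frame (hΦ : ∀ u v, Φ u v = Φ v u) {L : Submodule ℂ V}
    (h : HasPrincipalMultiplicity B Φ L 2) {k : V} (hk : L = Submodule.span ℂ {k}) :
    ∃ l n, IsAdaptedFrame B k l n ∧ Φ k k = 0 ∧ Φ k n = 0 ∧ Φ ≠ 0 := by
  obtain ⟨k', l, n, hf, hL, hne, hm⟩ := h
  have hdvd : (Polynomial.X : Polynomial ℂ) ^ 2 ∣ ricciPoly Φ k' l n := by
    have := Polynomial.pow_rootMultiplicity_dvd (ricciPoly Φ k' l n) 0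
    rwa [hm, Polynomial.C_0, sub_zero] at this
  rw [Polynomial.X_pow_dvd_iff] at hdvd
  have hc := fun i => congrArg (Polynomial.coeff · i) (ricciPoly.eq_1 Φ k' l n)
  simp only [Polynomial.coeff_add, Polynomial.coeff_C_mul, Polynomial.coeff_C,
    Polynomial.coeff_X, Polynomial.coeff_X_pow] at hc
  have h0 : Φ k' k' = 0 := by
    simpa [hc] using hdvd 0 (by norm_num)
  have h1 : Φ k' n = 0 := by
    simpa [hc, hΦ n k', ← two_mul] using hdvd 1 (by norm_num)
  have hk' : k' ∈ Submodule.span ℂ {k} := by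
    rw [← hk, hL]; exact Submodule.mem_span_singleton_self k'
  obtain ⟨c, rfl⟩ := Submodule.mem_span_singleton.mp hk'
  have hc : c ≠ 0 := by
    rintro rfl
    have := hf.kl
    simp at this
  refine ⟨c • l, n, hf.smul_line hc rfl, by simpa [hc] using h0, by simpa [hc] using h1, ?_⟩
  rintro rfl
  exact hne (by simp [ricciPoly])

/-- In Petrov type D there is a frame adapted to both multiple principal null lines. -/
theorem IsTypeD.exists_frame (hB : ∀ u v, B u v = B v u) (hΦ : ∀ u v, Φ u v = Φ v u)
    (hV : Module.finrank ℂ V = 3) {L L' : Submodule ℂ V} (h : IsTypeD B Φ L L') {k : V}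
    (hk : L = Submodule.span ℂ {k}) :
    ∃ l n, IsAdaptedFrame B k l n ∧ Φ k k = 0 ∧ Φ k n = 0 ∧ Φ l l = 0 ∧ Φ l n = 0 ∧ Φ ≠ 0 := by
  obtain ⟨hLL, h1, h2⟩ := h
  obtain ⟨l₁, n₁, hf, hkk, hkn, hne⟩ := h1.exists_frame hΦ hk
  obtain ⟨k₂, -, -, -, hL', -⟩ := id h2
  obtain ⟨l₂, n₂, hf₂, hkk₂, hkn₂, -⟩ := h2.exists_frame hΦ hL'
  -- In dimension 3 a null vector orthogonal to the null vector `k` is a multiple of `k`, so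
  -- distinct null lines are never orthogonal.
  have hB0 : B k k₂ ≠ 0 := by
    intro h0
    have hd := hf.decomp hB hV k₂
    rw [hB k₂ k, h0, zero_smul, add_zero] at hd
    have hn : B k₂ n₁ = 0 := by
      have := hf₂.kk
      rw [hd] at this
      simp only [map_sub, map_smul, LinearMap.sub_apply, LinearMap.smul_apply, smul_eq_mul,
        hf.kk, hf.kn, hf.nn, hB n₁ k] at this
      have h3 : B k₂ n₁ ^ 2 = 0 := by linear_combination (-1 / 2) * this
      exact pow_eq_zero_iff (two_ne_zero) |>.mp h3
    rw [hn, mul_zero, zero_smul, sub_zero] at hd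
    refine hLL ?_
    rw [hk, hL', hd, Submodule.span_singleton_smul_eq]
    refine IsUnit.mk0 _ fun h0' => ?_
    rw [h0', zero_smul] at hd
    have := hf₂.kl
    rw [hd] at this
    simp at this
  set l := (B k k₂)⁻¹ • k₂ with hl
  -- A null rotation about `k`: it makes `n` orthogonal to `l` and keeps its norm and its
  -- orthogonality to `k`.
  set n := n₁ - B n₁ l • k with hn
  have hkl : B k l = 1 := by simp [hl, hB0]
  have hln : B n l = 0 := by
    rw [hn]; simp [hkl]
  have hfr : IsAdaptedFrame B k l n := by
    refine ⟨hf.kk, by simp [hl, hf₂.kk], hkl, by simp [hn, hf.kn, hf.kk], by rw [hB, hln], ?_⟩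
    simp [hn, hf.kn, hf.kk, hf.nn, hB n₁ k]
  refine ⟨l, n, hfr, hkk, by simp [hn, hkn, hkk], by simp [hl, hkk₂], ?_, hne⟩
  have hnk₂ : B n k₂ = 0 := by
    have : B n l = (B k k₂)⁻¹ * B n k₂ := by simp [hl]
    rw [this] at hln
    simpa [hB0] using hln
  -- Being orthogonal to `k₂`, `n` is a combination of `k₂` and `n₂`, and `Φ k₂` annihilates both.
  have hd := hf₂.decomp hB hV n
  rw [hnk₂, zero_smul, add_zero] at hd
  have : Φ k₂ n = 0 := by
    rw [hd]; simp [hkk₂, hkn₂]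
  simp [hl, this]

/-- The type D normal form `Φ = f (g + 6 n ⊗ n)` in an adapted frame. -/
theorem IsAdaptedFrame.normal_form {k l n : V} (h : IsAdaptedFrame B k l n)
    (hB : ∀ u v, B u v = B v u) (hΦ : ∀ u v, Φ u v = Φ v u)
    (hV : Module.finrank ℂ V = 3) (hkk : Φ k k = 0) (hkn : Φ k n = 0) (hll : Φ l l = 0)
    (hln : Φ l n = 0) (hne : Φ ≠ 0) (htr : Φ k l = Φ n n) :
    Φ k l ≠ 0 ∧ (∀ v, Φ k v = Φ k l * B k v) ∧ ∀ v, Φ n v = -2 * Φ k l * B n v := by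
  have e1 : ∀ v, Φ k v = Φ k l * B k v := by
    intro v
    conv_lhs => rw [h.decomp hB hV v]
    simp [hkk, hkn, hB k v, mul_comm]
  have e2 : ∀ v, Φ n v = -2 * Φ k l * B n v := by
    intro v
    conv_lhs => rw [h.decomp hB hV v]
    simp only [map_sub, map_add, map_smul, smul_eq_mul, hΦ n k, hΦ n l, hkn, hln, ← htr, hB n v]
    ring
  refine ⟨fun h0 => hne ?_, e1, e2⟩
  ext u v
  rw [h.decomp hB hV u, hΦ, h.decomp hB hV v]
  simp [hkk, hkn, hll, hln, h0, ← htr, hΦ l k, hΦ n k, hΦ n l]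

end Algebra

/-! ### Frame contractions and the pointwise argument. -/

section CoordinateFrames

theorem bilin_apply (M : Matrix (Fin 3) (Fin 3) ℂ) (u v : Fin 3 → ℂ) :
    Matrix.toBilin' M u v = ∑ i, ∑ j, u i * M i j * v j := Matrix.toBilin'_apply M u v

theorem bilin_symm {M : Matrix (Fin 3) (Fin 3) ℂ} (h : ∀ i j, M i j = M j i) (u v : Fin 3 → ℂ) :
    Matrix.toBilin' M u v = Matrix.toBilin' M v u := by
  rw [bilin_apply, bilin_apply, Finset.sum_comm]
  exact Finset.sum_congr rfl fun i _ => Finset.sum_congr rfl fun j _ => by rw [h j i]; ring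

/-- The inverse metric in an adapted frame. -/
theorem inv_eq_of_isAdaptedFrame {M : Matrix (Fin 3) (Fin 3) ℂ} (h : ∀ i j, M i j = M j i)
    {k l n : Fin 3 → ℂ} (hf : IsAdaptedFrame (Matrix.toBilin' M) k l n) (a b : Fin 3) :
    M⁻¹ a b = k a * l b + l a * k b - 2 * n a * n b := by
  have h1 : Matrix.of (fun a b => k a * l b + l a * k b - 2 * n a * n b) * M = 1 := by
    ext i m
    -- Completeness relation: the frame expansion of each standard basis vector.
    have hd := congrFun (hf.decomp (bilin_symm h) (by simp) (Pi.single m 1)) i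
    have hs : ∀ v, Matrix.toBilin' M (Pi.single m 1) v = ∑ j, v j * M j m := fun v => by
      rw [bilin_apply]
      simp only [Pi.single_apply, ite_mul, one_mul, zero_mul, Finset.sum_ite_irrel,
        Finset.sum_const_zero, Finset.sum_ite_eq', Finset.mem_univ, if_true]
      exact Finset.sum_congr rfl fun j _ => by rw [h m j, mul_comm]
    simp only [hs, Pi.add_apply, Pi.sub_apply, Pi.smul_apply, smul_eq_mul] at hd
    rw [Matrix.one_apply, ← Pi.single_apply m (1 : ℂ) i, hd, Matrix.mul_apply]
    simp only [Matrix.of_apply, Fin.sum_univ_three]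
    ring
  rw [Matrix.inv_eq_left_inv h1, Matrix.of_apply]

/-- Frees the differentiated eigenvector equation from indices. In its use `v = gk`, `w = Φk`, `U`
is `∇k` with its vector index lowered, and `T` is the covariant derivative of `Φk`. -/
theorem contract_eigenvector {T U : Fin 3 → Fin 3 → ℂ} {v w : Fin 3 → ℂ}
    (h : ∀ b a d, T b a * v d + w a * U b d = T b d * v a + w d * U b a) (x y z : Fin 3 → ℂ) :
    (∑ b, ∑ a, x b * T b a * y a) * (∑ d, z d * v d)
        + (∑ a, y a * w a) * (∑ b, ∑ d, x b * U b d * z d)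
      = (∑ b, ∑ a, x b * T b a * z a) * (∑ d, y d * v d)
        + (∑ a, z a * w a) * (∑ b, ∑ d, x b * U b d * y d) := by
  have hs : ∑ b, ∑ a, ∑ d, x b * y a * z d * (T b a * v d + w a * U b d)
      = ∑ b, ∑ a, ∑ d, x b * y a * z d * (T b d * v a + w d * U b a) := by simp only [h]
  simp only [Fin.sum_univ_three] at hs ⊢
  linear_combination hs

/-- The pointwise form of the argument: differentiating the eigenvector equation for `k` and using
the contracted Bianchi identity and the type II condition forces
`n · ∇_k k = 0` and `n · ∇_n k = 0`. -/
theorem geodetic_of_obstruction {B Φ : Matrix (Fin 3) (Fin 3) ℂ} (hB : ∀ i j, B i j = B j i)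
    {k l n : Fin 3 → ℂ} (hf : IsAdaptedFrame (Matrix.toBilin' B) k l n)
    {f : ℂ} (hf0 : f ≠ 0) (hΦ : ∀ i j, Φ i j = Φ j i)
    (hΦk : ∀ v, Matrix.toBilin' Φ k v = f * Matrix.toBilin' B k v)
    (hΦn : ∀ v, Matrix.toBilin' Φ n v = -2 * f * Matrix.toBilin' B n v)
    {dΦ : Fin 3 → Fin 3 → Fin 3 → ℂ} {s : Fin 3 → ℂ} {K : Matrix (Fin 3) (Fin 3) ℂ}
    (hnull : ∀ u, Matrix.toBilin' B k (Matrix.vecMul u K) = 0)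
    (heig : ∀ b a d, (∑ c, dΦ b a c * k c + ∑ c, Φ a c * K b c) * (∑ c, B d c * k c)
        + (∑ c, Φ a c * k c) * (∑ c, B d c * K b c)
      = (∑ c, dΦ b d c * k c + ∑ c, Φ d c * K b c) * (∑ c, B a c * k c)
        + (∑ c, Φ d c * k c) * (∑ c, B a c * K b c))
    (hII : ∀ m, ∑ a, ∑ b, k a * k b *
      (-dΦ b m a + dΦ m b a - B m a * s b + B b a * s m + 3 * B b m * s a) = 0)
    (hdiv : ∀ a, ∑ e, ∑ b, (B⁻¹) e b * dΦ e b a = 2 * s a) :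
    Matrix.toBilin' B n (Matrix.vecMul k K) = 0 ∧ Matrix.toBilin' B n (Matrix.vecMul n K) = 0 := by
  have hBs := bilin_symm hB
  have hΦs := bilin_symm hΦ
  -- These are the only components of `∇Φ` that enter; `Matrix.vecMul x K` plays the role of `∇_x
  -- k`.
  let δ : (Fin 3 → ℂ) → (Fin 3 → ℂ) → ℂ := fun x y => ∑ b, ∑ a, x b * (∑ c, dΦ b a c * k c) * y a
  have hT : ∀ x y, ∑ b, ∑ a, x b * (∑ c, dΦ b a c * k c + ∑ c, Φ a c * K b c) * y a
      = δ x y + Matrix.toBilin' Φ y (Matrix.vecMul x K) := by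
    intro x y
    simp only [δ, bilin_apply, Matrix.vecMul, dotProduct, Fin.sum_univ_three]
    ring
  have hv : ∀ (M : Matrix (Fin 3) (Fin 3) ℂ) (z : Fin 3 → ℂ), ∑ d, z d * ∑ c, M d c * k c
      = Matrix.toBilin' M z k := by
    intro M z
    simp only [bilin_apply, Finset.mul_sum, mul_assoc]
  have hU : ∀ x z, ∑ b, ∑ d, x b * (∑ c, B d c * K b c) * z d
      = Matrix.toBilin' B z (Matrix.vecMul x K) := by
    intro x z
    simp only [bilin_apply, Matrix.vecMul, dotProduct, Fin.sum_univ_three]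
    ring
  -- The third contraction vector is `l`, because `g(k, l) = 1` solves the minors for the `y`
  -- component.
  have key : ∀ x y, δ x y + Matrix.toBilin' Φ y (Matrix.vecMul x K)
      + f * Matrix.toBilin' B k y * Matrix.toBilin' B l (Matrix.vecMul x K)
      = (δ x l + Matrix.toBilin' Φ l (Matrix.vecMul x K)) * Matrix.toBilin' B k y
        + f * Matrix.toBilin' B y (Matrix.vecMul x K) := by
    intro x y
    have h := contract_eigenvector heig x y l
    rw [hT, hT, hv, hv, hv, hv, hU, hU, hΦs y k, hΦs l k, hΦk, hΦk, hBs l k, hBs y k, hf.kl] at h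
    linear_combination h
  have hδk : ∀ x, δ x k = 0 := by
    intro x
    have h := key x k
    rw [hΦk, hnull, hf.kk] at h
    linear_combination h
  -- The factor `3f` is the gap between the eigenvalues `f` and `-2f`.
  have hδn : ∀ x, δ x n = 3 * f * Matrix.toBilin' B n (Matrix.vecMul x K) := by
    intro x
    have h := key x n
    rw [hΦn, hf.kn] at h
    linear_combination h
  -- The coefficient 2 is 3 from the obstruction minus 1 from the Cotton tensor; the other `S` term
  -- carries `g(k, k) = 0`.
  have hII' : ∀ y, -δ k y + δ y k + 2 * Matrix.toBilin' B k y * (∑ a, k a * s a) = 0 := by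
    intro y
    have h : ∑ m, y m * ∑ a, ∑ b, k a * k b *
        (-dΦ b m a + dΦ m b a - B m a * s b + B b a * s m + 3 * B b m * s a) = 0 := by
      simp only [hII, mul_zero, Finset.sum_const_zero]
    have h2 : ∑ m, y m * ∑ a, ∑ b, k a * k b *
        (-dΦ b m a + dΦ m b a - B m a * s b + B b a * s m + 3 * B b m * s a)
        = -δ k y + δ y k - Matrix.toBilin' B y k * (∑ a, k a * s a)
          + Matrix.toBilin' B k k * (∑ a, y a * s a)
          + 3 * Matrix.toBilin' B k y * (∑ a, k a * s a) := by
      simp only [δ, bilin_apply, Fin.sum_univ_three]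
      ring
    rw [h2, hf.kk, hBs y k] at h
    linear_combination h
  have hdiv' : δ k l + δ l k - 2 * δ n n = 2 * ∑ a, k a * s a := by
    have h : ∑ a, k a * ∑ e, ∑ b, (B⁻¹) e b * dΦ e b a = ∑ a, k a * (2 * s a) := by
      simp only [hdiv]
    simp only [inv_eq_of_isAdaptedFrame hB hf] at h
    simp only [δ, Fin.sum_univ_three] at h ⊢
    linear_combination h
  -- The direction `n` settles `∇_k k`; the direction `l`, combined with the divergence, settles
  -- `∇_n k`.
  have h1 := hII' n
  have h2 := hII' l
  rw [hδk, hf.kn, hδn] at h1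
  rw [hδk, hf.kl] at h2
  rw [hδk, hδn] at hdiv'
  constructor
  · have : f * Matrix.toBilin' B n (Matrix.vecMul k K) = 0 := by
      linear_combination (-1 / 3) * h1
    exact (mul_eq_zero.mp this).resolve_left hf0
  · have : f * Matrix.toBilin' B n (Matrix.vecMul n K) = 0 := by
      linear_combination (-1 / 6) * hdiv' - (1 / 6) * h2
    exact (mul_eq_zero.mp this).resolve_left hf0

/-- In the frame the trace of `Φ` is `2 Φ(k, l) - 2 Φ(n, n)`. -/
theorem trace_eq_of_isAdaptedFrame {B Φ : Matrix (Fin 3) (Fin 3) ℂ} (hB : ∀ i j, B i j = B j i)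
    (hΦ : ∀ i j, Φ i j = Φ j i) {k l n : Fin 3 → ℂ}
    (hf : IsAdaptedFrame (Matrix.toBilin' B) k l n) (htr : ∑ a, ∑ b, (B⁻¹) a b * Φ a b = 0) :
    Matrix.toBilin' Φ k l = Matrix.toBilin' Φ n n := by
  have hs := bilin_symm hΦ l k
  simp only [inv_eq_of_isAdaptedFrame hB hf] at htr
  simp only [bilin_apply, Fin.sum_univ_three] at htr hs ⊢
  linear_combination (1 / 2) * htr - (1 / 2) * hs

end CoordinateFrames

/-! ### Co-geodeticity in a coordinate domain. -/

section CoordinateCoGeodetic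

variable {G : E3 → Matrix (Fin 3) (Fin 3) ℂ} {V : Set E3}

/-- The matrix of the tracefree Ricci tensor. -/
def tracefreeRicciMatrix (G : E3 → Matrix (Fin 3) (Fin 3) ℂ) (x : E3) :
    Matrix (Fin 3) (Fin 3) ℂ :=
  Matrix.of fun a b => tracefreeRicci G a b x

/-- In coordinates: if the tracefree Ricci tensor has the type D normal form in a frame extending
the field `k`, and the type II condition holds for `k`, then `g(k, ∇_X Y) = 0` for `X`, `Y`
orthogonal to `k`. -/
theorem IsCoordMetric.coGeodetic (hG : IsCoordMetric G V) {k : Fin 3 → E3 → ℂ}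
    (hk : ∀ a, ContDiffOn ℝ ∞ (k a) V)
    (hframe : ∀ x ∈ V, ∃ l n : Fin 3 → ℂ, ∃ f : ℂ, f ≠ 0 ∧
      IsAdaptedFrame (Matrix.toBilin' (G x)) (k · x) l n ∧
      (∀ v, Matrix.toBilin' (tracefreeRicciMatrix G x) (k · x) v
        = f * Matrix.toBilin' (G x) (k · x) v) ∧
      ∀ v, Matrix.toBilin' (tracefreeRicciMatrix G x) n v
        = -2 * f * Matrix.toBilin' (G x) n v)
    {x : E3} (hx : x ∈ V)
    (hII : ∀ m, ∑ a, ∑ b, k a x * k b x *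
      (cotton G a b m x + 3 * G x b m * pd a (scalarS G) x) = 0)
    {X : Fin 3 → ℂ} (hX : Matrix.toBilin' (G x) (k · x) X = 0) {Y : Fin 3 → E3 → ℂ}
    (hY : ∀ a, ContDiffOn ℝ ∞ (Y a) V)
    (hYk : ∀ y ∈ V, Matrix.toBilin' (G y) (k · y) (Y · y) = 0) :
    Matrix.toBilin' (G x) (k · x) (fun a => ∑ b, X b * covDerivComp G Y b a x) = 0 := by
  have hBs := fun y hy => bilin_symm (hG.symm y hy)
  have hΦ : ∀ y ∈ V, ∀ i j, tracefreeRicciMatrix G y i j = tracefreeRicciMatrix G y j i :=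
    fun y hy i j => hG.tracefreeRicci_symm hy i j
  have hlow : ∀ (M : Matrix (Fin 3) (Fin 3) ℂ), (∀ i j, M i j = M j i) → ∀ u v : Fin 3 → ℂ,
      ∑ a, (∑ c, M a c * u c) * v a = Matrix.toBilin' M u v := by
    intro M hM u v
    rw [bilin_symm hM u v]
    simp only [bilin_apply, Finset.sum_mul]
    exact Finset.sum_congr rfl fun _ _ => Finset.sum_congr rfl fun _ _ => by ring
  let K : Matrix (Fin 3) (Fin 3) ℂ := Matrix.of fun b a => covDerivComp G k b a x
  -- Moves the derivative from `W` to `k`. With `W = k` it yields `g(k, ∇_u k) = 0`; with `W = Y` it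
  -- reduces the goal to `g(∇_X k, Y) = 0`.
  have horth : ∀ {W : Fin 3 → E3 → ℂ}, (∀ a, ContDiffOn ℝ ∞ (W a) V) →
      (∀ y ∈ V, Matrix.toBilin' (G y) (k · y) (W · y) = 0) → ∀ u : Fin 3 → ℂ,
      Matrix.toBilin' (G x) (Matrix.vecMul u K) (W · x)
        + Matrix.toBilin' (G x) (k · x) (fun a => ∑ b, u b * covDerivComp G W b a x) = 0 := by
    intro W hW hkW u
    have h := fun b => hG.covDeriv_orthogonal hk hW
      (fun y hy => by rw [hlow _ (hG.symm y hy)]; exact hkW y hy) hx b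
    simp only [hlow _ (hG.symm x hx)] at h
    have h2 : ∑ b, u b * (Matrix.toBilin' (G x) (covDerivComp G k b · x) (W · x)
        + Matrix.toBilin' (G x) (k · x) (covDerivComp G W b · x)) = 0 := by
      simp only [h, mul_zero, Finset.sum_const_zero]
    rw [← h2]
    simp only [K, bilin_apply, Matrix.vecMul, dotProduct, Fin.sum_univ_three, Matrix.of_apply]
    ring
  have hframe' := hframe
  obtain ⟨l, n, f, hf0, hf, hΦk, hΦn⟩ := hframe x hx
  have hkk : ∀ u, Matrix.toBilin' (G x) (k · x) (Matrix.vecMul u K) = 0 := by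
    intro u
    have h := horth hk (fun y hy => (hframe' y hy).choose_spec.choose_spec.choose_spec.2.1.kk) u
    rw [hBs x hx] at h
    have h2 : (fun a => ∑ b, u b * covDerivComp G k b a x) = Matrix.vecMul u K := rfl
    rw [h2, ← two_mul] at h
    simpa using h
  have heig : ∀ y ∈ V, ∀ a d, (∑ c, tracefreeRicci G a c y * k c y) * (∑ c, G y d c * k c y)
      = (∑ c, tracefreeRicci G d c y * k c y) * (∑ c, G y a c * k c y) := by
    intro y hy
    obtain ⟨l, n, f, -, -, h, -⟩ := hframe' y hy
    have e : ∀ a, ∑ c, tracefreeRicci G a c y * k c y = f * ∑ c, G y a c * k c y := by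
      intro a
      have := h (Pi.single a 1)
      rw [← hlow _ (hΦ y hy), ← hlow _ (hG.symm y hy)] at this
      simpa [Pi.single_apply, tracefreeRicciMatrix] using this
    intro a d
    rw [e, e]; ring
  obtain ⟨h1, h2⟩ := geodetic_of_obstruction (hG.symm x hx) hf hf0 (hΦ x hx) hΦk hΦn
    (dΦ := fun a b c => covDeriv₂ G (tracefreeRicci G) a b c x)
    (s := fun a => pd a (scalarS G) x) hkk (hG.covDeriv_eigenvector hk heig hx)
    (fun m => by simpa only [hG.cotton_eq hx] using hII m)
    (fun a => by simpa only [hG.covDeriv₂_tracefreeRicci_symm hx _ a] using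
      hG.divergence_tracefreeRicci hx a)
  -- `k^⊥` is spanned by `k` and `n`, so only `g(k, ∇_X k)`, `g(n, ∇_k k)` and `g(n, ∇_n k)` need to
  -- vanish.
  have hdecomp : ∀ v, Matrix.toBilin' (G x) (k · x) v = 0 → ∃ α β : ℂ, v = α • (k · x) + β • n := by
    intro v hv
    have hd := hf.decomp (hBs x hx) (by simp) v
    rw [hBs x hx v (k · x), hv, zero_smul, add_zero] at hd
    rw [sub_eq_add_neg, ← neg_smul] at hd
    exact ⟨_, _, hd⟩
  have h3 := horth hY hYk X
  suffices h : Matrix.toBilin' (G x) (Matrix.vecMul X K) (Y · x) = 0 by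
    rwa [h, zero_add] at h3
  obtain ⟨α, β, rfl⟩ := hdecomp X hX
  obtain ⟨γ, ε, hY'⟩ := hdecomp _ (hYk x hx)
  rw [hY', hBs x hx]
  simp only [Matrix.add_vecMul, Matrix.smul_vecMul, map_add, map_smul, LinearMap.add_apply,
    LinearMap.smul_apply, hkk, h1, h2, smul_zero, add_zero]

end CoordinateCoGeodetic

/-! ### Passage between the manifold and chart components. -/

section Charts

variable {M : Type*} [TopologicalSpace M] [ChartedSpace E3 M]

theorem comp_smul_tmul (c : OpenPartialHomeomorph M E3) (p : M) (i : Fin 3)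
    (v : TangentSpace (𝓡 3) p) : comp c p i ((1 : ℂ) ⊗ₜ[ℝ] v) = (dcoord c p i v : ℂ) := by
  rw [comp_tmul]; simp

theorem eq_sum_smul_single (w : E3) : w = ∑ i, w i • (EuclideanSpace.single i (1 : ℝ) : E3) := by
  ext j
  simp [Pi.single_apply]

theorem finrank_cTangent (p : M) : Module.finrank ℂ (CTangent p) = 3 := by
  change Module.finrank ℂ (ℂ ⊗[ℝ] E3) = 3
  rw [Module.finrank_baseChange]
  simp

variable {c : OpenPartialHomeomorph M E3} (hc : c ∈ charts M)
include hc

theorem mdifferentiable_of_mem_charts : c.MDifferentiable (𝓡 3) (𝓡 3) :=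
  ⟨fun _ hx => ((contMDiffAt_of_mem_maximalAtlas hc hx).mdifferentiableAt
      (by simp)).mdifferentiableWithinAt,
    fun _ hx => ((contMDiffAt_symm_of_mem_maximalAtlas hc hx).mdifferentiableAt
      (by simp)).mdifferentiableWithinAt⟩

theorem comp_coordVec {x : E3} (hx : x ∈ c.target) (i j : Fin 3) :
    comp c (c.symm x) i (coordVec c x j) = if i = j then 1 else 0 := by
  rw [coordVec, comp_smul_tmul]
  have h := (mdifferentiable_of_mem_charts hc).comp_symm_deriv hx
  have h2 := congrArg (fun L => (show E3 from L (EuclideanSpace.single j (1 : ℝ))) i) h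
  have h3 : dcoord c (c.symm x) i (mfderiv (𝓡 3) (𝓡 3) c.symm x (EuclideanSpace.single j (1 : ℝ)))
      = (EuclideanSpace.single j (1 : ℝ) : E3) i := h2
  rw [h3]
  by_cases hij : i = j <;> simp [hij]

theorem sum_comp_smul_coordVec {x : E3} (hx : x ∈ c.target) (v : CTangent (c.symm x)) :
    ∑ i, comp c (c.symm x) i v • coordVec c x i = v := by
  have h := (mdifferentiable_of_mem_charts hc).symm_comp_deriv (c.map_target hx)
  rw [c.right_inv hx] at h
  induction v using TensorProduct.induction_on with
  | zero => simp
  | add u v hu hv =>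
    simp only [map_add, add_smul, Finset.sum_add_distrib, hu, hv]
  | tmul a w =>
    have hw : ∑ i, dcoord c (c.symm x) i w •
        (mfderiv (𝓡 3) (𝓡 3) c.symm x (EuclideanSpace.single i (1 : ℝ)) :
          TangentSpace (𝓡 3) (c.symm x)) = w := by
      have h1 : mfderiv (𝓡 3) (𝓡 3) c.symm x (mfderiv (𝓡 3) (𝓡 3) c (c.symm x) w) = w :=
        congrArg (fun L => L w) h
      have h2 : (mfderiv (𝓡 3) (𝓡 3) c (c.symm x) w : E3)
          = ∑ i, dcoord c (c.symm x) i w • (EuclideanSpace.single i (1 : ℝ) : E3) :=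
        eq_sum_smul_single _
      conv_rhs => rw [← h1]
      erw [h2, map_sum]
      exact Finset.sum_congr rfl fun i _ => (map_smul _ _ _).symm
    conv_rhs => rw [← hw, TensorProduct.tmul_sum]
    refine Finset.sum_congr rfl fun i _ => ?_
    rw [comp_tmul, coordVec, TensorProduct.smul_tmul', TensorProduct.tmul_smul]
    simp [TensorProduct.smul_tmul']

namespace ComplexMetric

variable (g : ComplexMetric M)

theorem form_eq {x : E3} (hx : x ∈ c.target) (u v : CTangent (c.symm x)) :
    g.form (c.symm x) u v = Matrix.toBilin' (g.coeff c x) (comp c (c.symm x) · u)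
      (comp c (c.symm x) · v) := by
  conv_lhs => rw [← sum_comp_smul_coordVec hc hx u, ← sum_comp_smul_coordVec hc hx v]
  rw [bilin_apply]
  simp only [map_sum, LinearMap.sum_apply, map_smul, LinearMap.smul_apply, smul_eq_mul, coeff,
    Matrix.of_apply, Finset.mul_sum]
  exact Finset.sum_comm.trans (Finset.sum_congr rfl fun _ _ => Finset.sum_congr rfl fun _ _ => by
    ring)

theorem isCoordMetric {V : Set E3} (hV : IsOpen V) (hVc : V ⊆ c.target) :
    IsCoordMetric (g.coeff c) V where
  isOpen := hV
  smooth i j := (g.smooth c hc i j).mono hVc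
  symm x _ i j := g.symm _ _ _
  det_ne_zero x hx h := by
    obtain ⟨v, hv0, hv⟩ := Matrix.exists_mulVec_eq_zero_iff.mpr h
    have hx := hVc hx
    have hcv : ∀ i, comp c (c.symm x) i (∑ j, v j • coordVec c x j) = v i := by
      intro i
      simp [map_sum, comp_coordVec hc hx]
    -- A kernel vector of the coefficient matrix gives a tangent vector orthogonal to everything.
    have h0 : ∑ j, v j • coordVec c x j = 0 := by
      refine g.nondegenerate _ _ fun w => ?_
      rw [g.symm, g.form_eq hc hx, bilin_apply]
      refine Finset.sum_eq_zero fun i _ => ?_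
      have := congrFun hv i
      simp only [Matrix.mulVec, dotProduct, Pi.zero_apply] at this
      simp only [hcv, mul_assoc, ← Finset.mul_sum, this, mul_zero]
    refine hv0 (funext fun i => ?_)
    rw [← hcv i, h0, map_zero]; rfl

omit hc in
theorem tracefreeRicciAt_eq {x : E3} (hx : x ∈ c.target) (u v : CTangent (c.symm x)) :
    g.tracefreeRicciAt c (c.symm x) u v
      = Matrix.toBilin' (tracefreeRicciMatrix (g.coeff c) x) (comp c (c.symm x) · u)
        (comp c (c.symm x) · v) := by
  rw [bilin_apply]
  simp only [tracefreeRicciAt, c.right_inv hx, LinearMap.sum_apply, LinearMap.smul_apply,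
    LinearMap.BilinForm.linMulLin_apply, smul_eq_mul, tracefreeRicciMatrix, Matrix.of_apply]
  exact Finset.sum_congr rfl fun _ _ => Finset.sum_congr rfl fun _ _ => by ring

end ComplexMetric

variable {g : ComplexMetric M}

/-- The type D normal form in the coordinates of a chart. -/
theorem IsTypeD.exists_coord_frame {x : E3} (hx : x ∈ c.target)
    {L L' : Submodule ℂ (CTangent (c.symm x))}
    (h : IsTypeD (g.form (c.symm x)) (g.tracefreeRicciAt c (c.symm x)) L L')
    {k : CTangent (c.symm x)} (hk : L = Submodule.span ℂ {k}) :
    ∃ l n : Fin 3 → ℂ, ∃ f : ℂ, f ≠ 0 ∧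
      IsAdaptedFrame (Matrix.toBilin' (g.coeff c x)) (comp c (c.symm x) · k) l n ∧
      (∀ v, Matrix.toBilin' (tracefreeRicciMatrix (g.coeff c) x) (comp c (c.symm x) · k) v
        = f * Matrix.toBilin' (g.coeff c x) (comp c (c.symm x) · k) v) ∧
      ∀ v, Matrix.toBilin' (tracefreeRicciMatrix (g.coeff c) x) n v
        = -2 * f * Matrix.toBilin' (g.coeff c x) n v := by
  have hG := g.isCoordMetric hc c.open_target subset_rfl
  have hΦM : ∀ i j, tracefreeRicciMatrix (g.coeff c) x i j
      = tracefreeRicciMatrix (g.coeff c) x j i := hG.tracefreeRicci_symm hx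
  have hΦ : ∀ u v, g.tracefreeRicciAt c (c.symm x) u v = g.tracefreeRicciAt c (c.symm x) v u :=
    fun u v => by
      rw [g.tracefreeRicciAt_eq hx, g.tracefreeRicciAt_eq hx, bilin_symm hΦM]
  obtain ⟨l, n, hf, hkk, hkn, hll, hln, hne⟩ :=
    h.exists_frame (g.symm _) hΦ (finrank_cTangent _) hk
  have hf' : IsAdaptedFrame (Matrix.toBilin' (g.coeff c x)) (comp c (c.symm x) · k)
      (comp c (c.symm x) · l) (comp c (c.symm x) · n) := by
    constructor <;> rw [← g.form_eq hc hx]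
    exacts [hf.kk, hf.ll, hf.kl, hf.kn, hf.ln, hf.nn]
  have htr := trace_eq_of_isAdaptedFrame (hG.symm x hx) hΦM hf' (hG.trace_tracefreeRicci hx)
  rw [← g.tracefreeRicciAt_eq hx, ← g.tracefreeRicciAt_eq hx] at htr
  obtain ⟨h0, h1, h2⟩ := hf.normal_form (g.symm _) hΦ (finrank_cTangent _) hkk hkn hll hln hne htr
  have hsurj : ∀ v : Fin 3 → ℂ, ∃ w : CTangent (c.symm x), (comp c (c.symm x) · w) = v := fun v =>
    ⟨∑ j, v j • coordVec c x j, funext fun i => by simp [map_sum, comp_coordVec hc hx]⟩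
  refine ⟨_, _, _, h0, hf', fun v => ?_, fun v => ?_⟩
  · obtain ⟨w, rfl⟩ := hsurj v
    rw [← g.tracefreeRicciAt_eq hx, ← g.form_eq hc hx, h1]
  · obtain ⟨w, rfl⟩ := hsurj v
    rw [← g.tracefreeRicciAt_eq hx, ← g.form_eq hc hx, h2]

end Charts

/-! ### The theorem on the manifold. -/

section CoGeodetic

variable {M : Type*} [TopologicalSpace M] [ChartedSpace E3 M] {g : ComplexMetric M}

theorem NullStructure.isCoGeodetic_of_isTypeD {N N' : NullStructure g} (hD : IsTypeDWith g N N')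
    (hN : N.TypeIIObstructionVanishes) : N.IsCoGeodetic := by
  intro U hU X Y Z hX hY hZ hXp hYp hZp c hc p hp hpU
  obtain ⟨U', hU', hpU', k, hk, hkspan⟩ := N.smooth p
  obtain ⟨x, hx, rfl⟩ : ∃ x ∈ c.target, c.symm x = p := ⟨c p, c.map_source hp, c.left_inv hp⟩
  rw [c.right_inv hx]
  set V := c.target ∩ c.symm ⁻¹' (U ∩ U') with hVdef
  have hVo : IsOpen V := c.isOpen_inter_preimage_symm (hU.inter hU')
  have hVt : V ⊆ c.target := Set.inter_subset_left
  have hxV : x ∈ V := ⟨hx, hpU, hpU'⟩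
  have hG := g.isCoordMetric hc hVo hVt
  have hperp : ∀ {W : ∀ q : M, CTangent q}, (∀ q ∈ U, W q ∈ N.perp q) → ∀ y ∈ V,
      Matrix.toBilin' (g.coeff c y) (fieldComp k c · y) (fieldComp W c · y) = 0 := by
    intro W hW y hy
    have h : g.form (c.symm y) (k (c.symm y)) (W (c.symm y)) = 0 := by
      refine hW _ hy.2.1 _ ?_
      rw [hkspan _ hy.2.2]
      exact Submodule.mem_span_singleton_self _
    rwa [g.form_eq hc (hVt hy)] at h
  have main := hG.coGeodetic (k := fieldComp k c)
    (fun a => (hk c hc a).mono fun y hy => ⟨hy.1, hy.2.2⟩)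
    (fun y hy => IsTypeD.exists_coord_frame hc (hVt hy)
      (hD c hc _ (c.map_target (hVt hy))) (hkspan _ hy.2.2)) hxV
    (fun m => by
      have := hN c hc _ (c.map_target hx) _ (hkspan _ hpU') m
      rwa [c.right_inv hx] at this)
    (hperp hXp x hxV) (Y := fieldComp Y c)
    (fun a => (hY c hc a).mono fun y hy => ⟨hy.1, hy.2.1⟩) (hperp hYp)
  have hZ' := hZp _ hpU
  rw [hkspan _ hpU', Submodule.mem_span_singleton] at hZ'
  obtain ⟨ζ, hζ⟩ := hZ'
  -- The expression is tensorial in `Z`, so its value `ζ k` at the single point suffices.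
  have hZc : ∀ b, fieldComp Z c b x = ζ * fieldComp k c b x := by
    intro b
    simp only [fieldComp, ← hζ, map_smul, smul_eq_mul]
  rw [bilin_symm (hG.symm x hxV), bilin_apply] at main
  have hcov : ∀ a, covDerivVec (g.coeff c) (fieldComp X c) (fieldComp Y c) a x
      = ∑ b, fieldComp X c b x * covDerivComp (g.coeff c) (fieldComp Y c) b a x := fun _ => rfl
  have h2 : ζ * ∑ a, ∑ b, (∑ i, fieldComp X c i x *
      covDerivComp (g.coeff c) (fieldComp Y c) i a x) * g.coeff c x a b * fieldComp k c b x = 0 := by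
    rw [main, mul_zero]
  rw [← h2]
  simp only [hZc, hcov, Finset.mul_sum (s := Finset.univ) (a := ζ)]
  exact Finset.sum_congr rfl fun _ _ => Finset.sum_congr rfl fun _ _ => by ring

theorem IsTypeDWith.symm {N N' : NullStructure g} (h : IsTypeDWith g N N') :
    IsTypeDWith g N' N :=
  fun c hc p hp => ⟨(h c hc p hp).1.symm, (h c hc p hp).2.2, (h c hc p hp).2.1⟩

end CoGeodetic

end NullGeometry

end

theorem mainTheorem8 {M : Type*} [TopologicalSpace M]
    [ChartedSpace (EuclideanSpace ℝ (Fin 3)) M] [IsManifold (𝓡 3) ∞ M]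
    (g : NullGeometry.ComplexMetric M) (N N' : NullGeometry.NullStructure g)
    (hD : NullGeometry.IsTypeDWith g N N')
    (hN : N.TypeIIObstructionVanishes) (hN' : N'.TypeIIObstructionVanishes) :
    N.IsCoGeodetic ∧ N'.IsCoGeodetic :=
  ⟨N.isCoGeodetic_of_isTypeD hD hN, N'.isCoGeodetic_of_isTypeD hD.symm hN'⟩
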